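/- Let $n>1$ be an odd integer and let $G=H\times\langle a\rangle$, where $H\cong\mathbb{Z}_{2n}$ and $\langle a\rangle\cong\mathbb{Z}_2$. Let $b$ be the unique involution of $H$ and let $H_0$ be the subgroup of $H$ of order $n$. For $X\subseteq G$ write $\underline{X}=\sum_{x\in X}x\in\mathbb{Z}G$ and $\mathrm{rad}(X)=\{g\in G: Xg=X \text{ and } gX=X\}$. Recall that a Schur ring (S-ring) over $G$ is a subring $\mathcal{A}$ of $\mathbb{Z}G$ for which there is a partition $\mathcal{S}(\mathcal{A})$ of $G$, whose classes are called the basic sets of $\mathcal{A}$, such that $\{1_G\}\in\mathcal{S}(\mathcal{A})$, $X^{-1}\in\mathcal{S}(\mathcal{A})$ for every $X\in\mathcal{S}(\mathcal{A})$, and $\mathcal{A}=\mathrm{Span}_{\mathbb{Z}}\{\underline{X}: X\in\mathcal{S}(\mathcal{A})\}$. If $\mathcal{A}$ is an S-ring over $G$ with $\underline{H}\in\mathcal{A}$ and $\underline{\{a\}}\notin\mathcal{A}$, then $\{a,ab\}$ is a basic set of $\mathcal{A}$, or $$\bigcap_{\substack{X\in\mathcal{S}(\mathcal{A})\\ X\cap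 H_0a\neq\emptyset}}\mathrm{rad}(X\cap H_0a)\neq 1.$$ -/

import Mathlib

open scoped Pointwise

noncomputable section

namespace SchurRings

/-- The element `∑ x ∈ X, x` of the integral group ring `ℤ G`, for a subset `X` of a finite
group `G`. -/
def underline {G : Type*} [Group G] [Finite G] (X : Set G) : MonoidAlgebra ℤ G :=
  ∑ x ∈ X.toFinite.toFinset, MonoidAlgebra.of ℤ G x

/-- A Schur ring over a finite group `G`: a subring of `ℤ G` which is the `ℤ`-span of the elements
`underline X`, where `X` runs over the classes (the basic sets) of a partition of `G` that
contains `{1}` and is closed under inversion. The partition is determined by the subring. -/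
structure SchurRing (G : Type*) [Group G] [Finite G] extends Subring (MonoidAlgebra ℤ G) where
  basicSets : Set (Set G)
  isPartition : Setoid.IsPartition basicSets
  one_mem_basicSets : {1} ∈ basicSets
  inv_mem_basicSets : ∀ X ∈ basicSets, X⁻¹ ∈ basicSets
  toSubring_eq_span : (toSubring : Set (MonoidAlgebra ℤ G)) =
    Submodule.span ℤ (underline '' basicSets)

/-- The radical `{g : Xg = X and gX = X}` of a subset `X` of a group. -/
def rad {G : Type*} [Group G] (X : Set G) : Subgroup G where
  carrier := {g | MulOpposite.op g • X = X ∧ g • X = X}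
  one_mem' := by simp
  mul_mem' := by
    rintro g h ⟨hg, hg'⟩ ⟨hh, hh'⟩
    refine ⟨?_, ?_⟩
    · rw [MulOpposite.op_mul, mul_smul, hg, hh]
    · rw [mul_smul, hh', hg']
  inv_mem' := by
    rintro g ⟨hg, hg'⟩
    refine ⟨?_, ?_⟩
    · rw [MulOpposite.op_inv, inv_smul_eq_iff, hg]
    · rw [inv_smul_eq_iff, hg']

end SchurRings

end

/-!
Reducing powers of the elements of an S-ring modulo a prime `q` shows that, for every `A`-set `V`,
the elements whose number of `q`-th roots in `V` is prime to `q` again form an `A`-set. For `q = 2`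
and `V` in the coset `H a`, whose elements `h a` and `h a b` with `h ∈ H₀` have the same square,
those `h` for which `V` contains exactly one of the two form an `A`-set, which lies in the largest
`A`-subgroup of `H₀`. Outside that subgroup `V` is invariant under multiplication by `b`.

The goal is one `r ≠ 1` in `H₀` with `h a` and `r h a` in the same basic set for all `h ∈ H₀`. Let
`T` be the basic set of `a`, and `U` the subgroup generated by the basic set of `b`.
* If `a b ∉ T`, then `T` misses the coset of `a b` modulo the largest `A`-subgroup of `H₀`, and
  comparing the numbers of factorizations through related elements extends translations of `T` to
  all of `H₀ a`.
* If `a b ∈ T` and `U ∩ H₀ = 1`, then `{b}` is a basic set and `T b = T`. Any `k a ∈ T` with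
  `1 ≠ k ∈ H₀` gives `r = k`: a basic set invariant under `b` is also invariant under `k` by
  squaring, and the others are handled by a parity count.
* If `a b ∈ T` and `U ∩ H₀ ≠ 1`, then `U` contains the subgroup `P` of some odd prime order `p`. A
  basic set in `H a` containing an element whose order has a small `p`-part is `P`-invariant in its
  higher layers by Schur's theorem on multipliers. One on a single layer that is not `P`-invariant
  would meet each coset of `P` there at most once, which contradicts the counts for `a` and `l a`
  and for `b` and `l b` with `1 ≠ l ∈ P`. Taking `p`-th powers settles the lowest layer.
-/

namespace SchurRings

theorem exists_sum_pow_prime_eq {R ι : Type*} [CommRing R] {q : ℕ} (hq : q.Prime) (s : Finset ι)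
    (f : ι → R) : ∃ r, (∑ i ∈ s, f i) ^ q = ∑ i ∈ s, f i ^ q + (q : R) * r := by
  classical
  induction s using Finset.induction_on with
  | empty => exact ⟨0, by simp [hq.ne_zero]⟩
  | insert i s hi ih =>
    obtain ⟨r, hr⟩ := ih
    obtain ⟨t, ht⟩ := exists_add_pow_prime_eq hq (f i) (∑ i ∈ s, f i)
    rw [Finset.sum_insert hi, Finset.sum_insert hi, ht, hr]
    exact ⟨r + f i * (∑ i ∈ s, f i) * t, by ring⟩

theorem mul_mem_of_mem_rad {G : Type*} [Group G] {X : Set G} {r x : G} (hr : r ∈ rad X)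
    (hx : x ∈ X) : r * x ∈ X :=
  hr.2 ▸ Set.smul_mem_smul_set hx

theorem ncard_setOf_mul_mul_mem {G : Type*} [CommGroup G] {K : Subgroup G} {k : G} (hk : k ∈ K)
    (X : Set G) (g : G) : {y | y ∈ K ∧ k * g * y ∈ X}.ncard = {y | y ∈ K ∧ g * y ∈ X}.ncard := by
  rw [← Set.ncard_smul_set k]
  congr 1
  ext y
  simp only [Set.mem_smul_set_iff_inv_smul_mem, smul_eq_mul, Set.mem_ofPred_eq]
  rw [K.mul_mem_cancel_left (K.inv_mem hk), mul_comm k, mul_assoc g, mul_inv_cancel_left]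

section Group

variable {G : Type*} [Group G] [Finite G]

open Classical in
theorem coeff_underline (X : Set G) (g : G) : (underline X).coeff g = if g ∈ X then 1 else 0 := by
  simp [underline, MonoidAlgebra.coeff_sum, Finsupp.finsetSum_apply, Finsupp.single_apply]

theorem coeff_sum_single_mul_underline {ι : Type*} (s : Finset ι) (f : ι → G) (Y : Set G) (g : G) :
    ((∑ i ∈ s, MonoidAlgebra.single (f i) (1 : ℤ)) * underline Y).coeff g =
      ({i | i ∈ s ∧ (f i)⁻¹ * g ∈ Y}.ncard : ℤ) := by
  classical
  simp only [Finset.sum_mul, MonoidAlgebra.coeff_sum, Finsupp.finsetSum_apply,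
    MonoidAlgebra.coeff_single_mul_apply, one_mul, coeff_underline, Finset.sum_boole]
  rw [← Set.ncard_coe_finset, Finset.coe_filter]

theorem coeff_underline_mul (X Y : Set G) (g : G) :
    (underline X * underline Y).coeff g = ({x | x ∈ X ∧ x⁻¹ * g ∈ Y}.ncard : ℤ) := by
  have hX : underline X = ∑ x ∈ X.toFinite.toFinset, MonoidAlgebra.single x 1 := rfl
  simpa only [Set.Finite.mem_toFinset, hX] using
    coeff_sum_single_mul_underline X.toFinite.toFinset (fun x => x) Y g

end Group

section Commutative

variable {G : Type*} [CommGroup G] [Finite G]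

theorem mem_rad_iff {X : Set G} {r : G} : r ∈ rad X ↔ ∀ x ∈ X, r * x ∈ X := by
  refine ⟨fun hr x => mul_mem_of_mem_rad hr, fun h => ?_⟩
  have hr : r • X = X :=
    Set.eq_of_subset_of_ncard_le (Set.smul_set_subset_iff.2 h) (Set.ncard_smul_set r X).ge
  exact ⟨by rwa [op_smul_eq_smul], hr⟩

namespace SchurRing

/-- The equivalence relation of lying in the same basic set of `A`. -/
def Rel (A : SchurRing G) (x y : G) : Prop :=
  Setoid.mkClasses A.basicSets A.isPartition.2 x y

/-- The basic set of `A` containing `x`. -/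
def basicSet (A : SchurRing G) (x : G) : Set G := {y | A.Rel x y}

/-- An `A`-set is a union of basic sets. -/
def IsASet (A : SchurRing G) (V : Set G) : Prop := ∀ ⦃x y⦄, A.Rel x y → x ∈ V → y ∈ V

variable {A : SchurRing G} {V W X Y : Set G} {x y z : G}

namespace Rel

theorem refl (x : G) : A.Rel x x := Setoid.refl' _ x

theorem symm (h : A.Rel x y) : A.Rel y x := Setoid.symm' _ h

theorem trans (hxy : A.Rel x y) (hyz : A.Rel y z) : A.Rel x z := Setoid.trans' _ hxy hyz

end Rel

theorem mem_basicSet_self (x : G) : x ∈ A.basicSet x := Rel.refl x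

theorem eq_basicSet_of_mem (hX : X ∈ A.basicSets) (hx : x ∈ X) : X = A.basicSet x := by
  rw [Setoid.eq_eqv_class_of_mem A.isPartition.2 hX hx]
  exact Set.ext fun y => ⟨Rel.symm, Rel.symm⟩

theorem basicSet_mem_basicSets (x : G) : A.basicSet x ∈ A.basicSets := by
  obtain ⟨X, ⟨hX, hx⟩, -⟩ := A.isPartition.2 x
  exact eq_basicSet_of_mem hX hx ▸ hX

theorem Rel.inv (h : A.Rel x y) : A.Rel x⁻¹ y⁻¹ := by
  have hx : x⁻¹ ∈ (A.basicSet x)⁻¹ := Set.inv_mem_inv.2 (mem_basicSet_self x)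
  have hy : y⁻¹ ∈ (A.basicSet x)⁻¹ := by rwa [Set.inv_mem_inv]
  rwa [eq_basicSet_of_mem (A.inv_mem_basicSets _ (basicSet_mem_basicSets x)) hx] at hy

theorem basicSet_one : A.basicSet 1 = {1} := (eq_basicSet_of_mem A.one_mem_basicSets rfl).symm

theorem isASet_basicSet (x : G) : A.IsASet (A.basicSet x) := fun _ _ h hx => Rel.trans hx h

namespace IsASet

theorem mem_iff (hV : A.IsASet V) (h : A.Rel x y) : x ∈ V ↔ y ∈ V := ⟨hV h, hV h.symm⟩

theorem inter (hV : A.IsASet V) (hW : A.IsASet W) : A.IsASet (V ∩ W) :=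
  fun _ _ h hx => ⟨hV h hx.1, hW h hx.2⟩

theorem union (hV : A.IsASet V) (hW : A.IsASet W) : A.IsASet (V ∪ W) :=
  fun _ _ h hx => hx.imp (@hV _ _ h) (@hW _ _ h)

theorem compl (hV : A.IsASet V) : A.IsASet Vᶜ := fun _ _ h hx hy => hx (hV h.symm hy)

theorem inv (hV : A.IsASet V) : A.IsASet V⁻¹ := fun _ _ h hx => hV h.inv hx

end IsASet

theorem coeff_eq_of_rel {f : MonoidAlgebra ℤ G} (hf : f ∈ A.toSubring) (h : A.Rel x y) :
    f.coeff x = f.coeff y := by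
  have hspan : f ∈ Submodule.span ℤ (underline '' A.basicSets) := by
    rw [← SetLike.mem_coe, ← A.toSubring_eq_span]; exact hf
  clear hf
  induction hspan using Submodule.span_induction with
  | mem f hf =>
    obtain ⟨X, hX, rfl⟩ := hf
    have hXA : A.IsASet X := by
      intro u v huv hu
      rw [eq_basicSet_of_mem hX hu]
      exact huv
    classical
    rw [coeff_underline, coeff_underline, if_congr (hXA.mem_iff h) rfl rfl]
  | zero => simp
  | add f g _ _ ihf ihg => simp [ihf, ihg]
  | smul c f _ ihf => rw [MonoidAlgebra.coeff_smul_apply, MonoidAlgebra.coeff_smul_apply, ihf]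

theorem underline_eq_sum_basicSets (hV : A.IsASet V) :
    underline V = ∑ X ∈ {X ∈ A.basicSets | X ⊆ V}.toFinite.toFinset, underline X := by
  classical
  ext g
  have hcoeff : ∀ X ∈ {X ∈ A.basicSets | X ⊆ V}.toFinite.toFinset,
      (underline X).coeff g = if A.basicSet g = X then 1 else 0 := by
    intro X hX
    have hX' : X ∈ A.basicSets := ((Set.Finite.mem_toFinset _).1 hX).1
    rw [coeff_underline]
    refine if_congr ⟨fun hg => (eq_basicSet_of_mem hX' hg).symm, ?_⟩ rfl rfl
    rintro rfl
    exact mem_basicSet_self g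
  have hmem : A.basicSet g ∈ {X ∈ A.basicSets | X ⊆ V} ↔ g ∈ V :=
    ⟨fun h => h.2 (mem_basicSet_self g), fun hg => ⟨basicSet_mem_basicSets g, fun _ h => hV h hg⟩⟩
  rw [MonoidAlgebra.coeff_sum, Finsupp.finsetSum_apply, Finset.sum_congr rfl hcoeff,
    Finset.sum_ite_eq, coeff_underline]
  exact if_congr (hmem.symm.trans (Set.Finite.mem_toFinset _).symm) rfl rfl

theorem isASet_iff_underline_mem : A.IsASet V ↔ underline V ∈ A.toSubring := by
  classical
  constructor
  · intro hV
    rw [underline_eq_sum_basicSets hV]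
    refine Subring.sum_mem _ fun X hX => ?_
    rw [← SetLike.mem_coe, A.toSubring_eq_span]
    exact Submodule.subset_span ⟨X, ((Set.Finite.mem_toFinset _).1 hX).1, rfl⟩
  · intro hV x y hxy hx
    by_contra hy
    simpa [coeff_underline, hx, hy] using coeff_eq_of_rel hV hxy

/-- The coefficients of `underline V * underline Y⁻¹` are constant on basic sets. -/
theorem ncard_eq_of_rel (hV : A.IsASet V) (hY : A.IsASet Y) (h : A.Rel x z) :
    {y | y ∈ Y ∧ x * y ∈ V}.ncard = {y | y ∈ Y ∧ z * y ∈ V}.ncard := by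
  have hcoeff := coeff_eq_of_rel (A.toSubring.mul_mem (isASet_iff_underline_mem.1 hY.inv)
    (isASet_iff_underline_mem.1 hV)) h
  have hinv : ∀ g : G, {y | y ∈ Y⁻¹ ∧ y⁻¹ * g ∈ V} = {y | y ∈ Y ∧ g * y ∈ V}⁻¹ := by
    intro g; ext y; simp [mul_comm]
  rw [coeff_underline_mul, coeff_underline_mul, hinv, hinv, Set.ncard_inv, Set.ncard_inv] at hcoeff
  exact_mod_cast hcoeff

theorem exists_mul_mem_of_rel (hV : A.IsASet V) (hY : A.IsASet Y) (h : A.Rel x z)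
    (hx : ∃ y ∈ Y, x * y ∈ V) : ∃ y ∈ Y, z * y ∈ V := by
  have hpos : 0 < {y | y ∈ Y ∧ x * y ∈ V}.ncard := (Set.ncard_pos).2 hx
  rwa [ncard_eq_of_rel hV hY h, Set.ncard_pos] at hpos

theorem forall_mul_mem_of_rel (hV : A.IsASet V) (hY : A.IsASet Y) (h : A.Rel x z)
    (hx : ∀ y ∈ Y, x * y ∈ V) : ∀ y ∈ Y, z * y ∈ V := by
  by_contra! hz
  obtain ⟨y, hy, hxy⟩ := exists_mul_mem_of_rel hV.compl hY h.symm hz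
  exact hxy (hx y hy)

theorem exists_of_rel_mul {g : G} (h : A.Rel (x * g) z) :
    ∃ y t, A.Rel x y ∧ A.Rel g t ∧ z = y * t := by
  obtain ⟨t, ht, hxt⟩ := exists_mul_mem_of_rel (isASet_basicSet x) (isASet_basicSet g).inv h
    ⟨g⁻¹, Set.inv_mem_inv.2 (mem_basicSet_self g), by simpa using mem_basicSet_self x⟩
  exact ⟨z * t, t⁻¹, hxt, ht, by simp⟩

namespace IsASet

theorem mul (hV : A.IsASet V) (hW : A.IsASet W) : A.IsASet (V * W) := by
  rintro _ z h ⟨v, hv, w, hw, rfl⟩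
  obtain ⟨y, t, hy, ht, rfl⟩ := exists_of_rel_mul h
  exact Set.mul_mem_mul (hV hy hv) (hW ht hw)

theorem rad (hV : A.IsASet V) : A.IsASet (rad V : Set G) := fun _ _ h hx =>
  mem_rad_iff.2 (forall_mul_mem_of_rel hV hV h (mem_rad_iff.1 hx))

end IsASet

theorem underline_mul_underline_subgroup {L : Subgroup G}
    (hW : ∀ w ∈ W, ∀ w' ∈ W, w⁻¹ * w' ∈ L → w = w') :
    underline (W * (L : Set G)) = underline W * underline (L : Set G) := by
  classical
  ext g
  rw [coeff_underline_mul, coeff_underline]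
  split_ifs with hg
  · obtain ⟨w, hw, l, hl, rfl⟩ := hg
    suffices {x | x ∈ W ∧ x⁻¹ * (w * l) ∈ (L : Set G)} = {w} by rw [this]; simp
    refine Set.eq_singleton_iff_unique_mem.2 ⟨⟨hw, by simpa using hl⟩, fun x ⟨hx, hxl⟩ => ?_⟩
    exact hW x hx w hw ((L.mul_mem_cancel_right hl).1 (by rwa [← mul_assoc] at hxl))
  · suffices {x | x ∈ W ∧ x⁻¹ * g ∈ (L : Set G)} = ∅ by rw [this]; simp
    refine Set.eq_empty_of_forall_notMem fun x ⟨hx, hxg⟩ => hg ⟨x, hx, x⁻¹ * g, hxg, by simp⟩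

theorem underline_subgroup_pow_succ (L : Subgroup G) (k : ℕ) :
    underline (L : Set G) ^ (k + 1) =
      (Nat.card L : MonoidAlgebra ℤ G) ^ k * underline (L : Set G) := by
  classical
  have hsq : underline (L : Set G) * underline (L : Set G) =
      (Nat.card L : MonoidAlgebra ℤ G) * underline (L : Set G) := by
    ext g
    rw [← nsmul_eq_mul, MonoidAlgebra.coeff_smul_apply, coeff_underline_mul, coeff_underline]
    split_ifs with hg
    · have hall : {x | x ∈ (L : Set G) ∧ x⁻¹ * g ∈ (L : Set G)} = L :=
        Set.ext fun x => ⟨And.left, fun hx => ⟨hx, L.mul_mem (L.inv_mem hx) hg⟩⟩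
      rw [hall, ← Nat.card_coe_set_eq]
      simp
    · have hnone : {x | x ∈ (L : Set G) ∧ x⁻¹ * g ∈ (L : Set G)} = ∅ :=
        Set.eq_empty_of_forall_notMem fun x ⟨hx, hxg⟩ =>
          hg ((L.mul_mem_cancel_left (L.inv_mem hx)).1 hxg)
      rw [hnone]
      simp
  induction k with
  | zero => simp
  | succ k ih => rw [pow_succ, ih, mul_assoc, hsq, ← mul_assoc, pow_succ]

/-- Reduce `underline (W * L) ^ q = underline W ^ q * underline L ^ q` modulo `q`, after dividing it
by `|L| ^ (q - 1)`: the Frobenius map turns the first factor into `∑ w ∈ W, w ^ q`. -/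
theorem IsASet.setOf_not_dvd_ncard_pow_inv_mul_mem {L : Subgroup G}
    (hWL : A.IsASet (W * (L : Set G))) (hW : ∀ w ∈ W, ∀ w' ∈ W, w⁻¹ * w' ∈ L → w = w')
    {q : ℕ} (hq : q.Prime) : A.IsASet {g | ¬ q ∣ {w | w ∈ W ∧ (w ^ q)⁻¹ * g ∈ L}.ncard} := by
  obtain ⟨r, hr⟩ := exists_sum_pow_prime_eq hq W.toFinite.toFinset (MonoidAlgebra.of ℤ G)
  have hpow : underline (W * (L : Set G)) ^ q = Nat.card L ^ (q - 1) •
      ((∑ w ∈ W.toFinite.toFinset, MonoidAlgebra.single (w ^ q) 1) * underline (L : Set G) +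
        q • (r * underline (L : Set G))) := by
    have hWq : underline W ^ q = ∑ w ∈ W.toFinite.toFinset, MonoidAlgebra.single (w ^ q) 1 +
        (q : MonoidAlgebra ℤ G) * r := by
      simpa only [underline, MonoidAlgebra.of_apply, MonoidAlgebra.single_pow, one_pow] using hr
    have hLq := underline_subgroup_pow_succ L (q - 1)
    rw [Nat.sub_add_cancel hq.one_le] at hLq
    rw [underline_mul_underline_subgroup hW, mul_pow, hWq, hLq, nsmul_eq_mul, nsmul_eq_mul]
    push_cast
    ring
  have hcoeff : ∀ g, (underline (W * (L : Set G)) ^ q).coeff g = (Nat.card L : ℤ) ^ (q - 1) *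
      ({w | w ∈ W ∧ (w ^ q)⁻¹ * g ∈ L}.ncard + q * (r * underline (L : Set G)).coeff g) := by
    intro g
    have hsum := coeff_sum_single_mul_underline W.toFinite.toFinset (· ^ q) (L : Set G) g
    simp only [Set.Finite.mem_toFinset, SetLike.mem_coe] at hsum
    rw [hpow, MonoidAlgebra.coeff_smul_apply, MonoidAlgebra.coeff_add, Finsupp.add_apply, hsum,
      MonoidAlgebra.coeff_smul_apply, nsmul_eq_mul, nsmul_eq_mul, Nat.cast_pow]
  intro x y hxy hx hy
  have heq := coeff_eq_of_rel (A.toSubring.pow_mem (isASet_iff_underline_mem.1 hWL) q) hxy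
  rw [hcoeff, hcoeff] at heq
  have hcard : (Nat.card L : ℤ) ^ (q - 1) ≠ 0 := pow_ne_zero _ (by exact_mod_cast Nat.card_pos.ne')
  refine hx (Int.natCast_dvd_natCast.1 ((Int.dvd_add_left
    (dvd_mul_right _ ((r * underline (L : Set G)).coeff x))).1 ?_))
  rw [mul_left_cancel₀ hcard heq]
  exact dvd_add (Int.natCast_dvd_natCast.2 hy) (dvd_mul_right _ _)

theorem IsASet.setOf_not_dvd_ncard_pow_eq (hV : A.IsASet V) {q : ℕ} (hq : q.Prime) :
    A.IsASet {g | ¬ q ∣ {x | x ∈ V ∧ x ^ q = g}.ncard} := by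
  have hVL : A.IsASet (V * ((⊥ : Subgroup G) : Set G)) := by simpa using hV
  simpa only [Subgroup.mem_bot, inv_mul_eq_one] using
    hVL.setOf_not_dvd_ncard_pow_inv_mul_mem (fun _ _ _ _ h => inv_mul_eq_one.1 h) hq

theorem IsASet.image_pow (hV : A.IsASet V) {m : ℕ} (hm : (Nat.card G).Coprime m) :
    A.IsASet ((· ^ m) '' V) := by
  induction m using induction_on_primes generalizing V with
  | zero =>
    have := (Nat.card_eq_one_iff_unique.1 ((Nat.coprime_zero_right _).1 hm)).1
    intro x y _ hx
    rwa [Subsingleton.elim y x]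
  | one => simpa using hV
  | prime_mul p m hp ih =>
    have hinj := (powCoprime (Nat.Coprime.coprime_mul_right_right hm)).injective
    have hp_image : (· ^ p) '' V = {g | ¬ p ∣ {x | x ∈ V ∧ x ^ p = g}.ncard} := by
      ext g
      constructor
      · rintro ⟨x, hx, rfl⟩
        have : {y | y ∈ V ∧ y ^ p = x ^ p} = {x} :=
          Set.eq_singleton_iff_unique_mem.2 ⟨⟨hx, rfl⟩, fun y hy => hinj hy.2⟩
        simpa [this] using hp.ne_one
      · intro hg
        obtain ⟨x, hx⟩ : {x | x ∈ V ∧ x ^ p = g}.Nonempty := by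
          rw [Set.nonempty_iff_ne_empty]
          intro h
          simp [h] at hg
        exact ⟨x, hx⟩
    have himage := ih (hp_image ▸ hV.setOf_not_dvd_ncard_pow_eq hp)
      (Nat.Coprime.coprime_mul_left_right hm)
    simpa only [Set.image_image, ← pow_mul] using himage

/-- Schur's theorem on multipliers: `x ↦ x ^ m` permutes the basic sets. -/
theorem Rel.pow (h : A.Rel x y) {m : ℕ} (hm : (Nat.card G).Coprime m) : A.Rel (x ^ m) (y ^ m) := by
  have hinv : ∀ z : G, (z ^ m) ^ m ^ ((Nat.card G).totient - 1) = z := by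
    intro z
    rw [← pow_mul, ← pow_succ', Nat.sub_add_cancel (Nat.totient_pos.2 Nat.card_pos)]
    simpa using pow_eq_pow_of_modEq (Nat.ModEq.pow_totient hm.symm) (pow_card_eq_one' (x := z))
  obtain ⟨w, hw, rfl⟩ := (isASet_basicSet (x ^ m)).image_pow
    (hm.pow_right ((Nat.card G).totient - 1)) h ⟨x ^ m, mem_basicSet_self _, hinv x⟩
  have hwm := hinv w
  rw [pow_right_comm] at hwm
  exact (congrArg _ hwm).mpr hw

/-- The largest subgroup of `K` that is an `A`-set. -/
def core (A : SchurRing G) (K : Subgroup G) : Subgroup G where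
  carrier := {x | A.basicSet x ⊆ K}
  one_mem' := by simp [basicSet_one, K.one_mem]
  mul_mem' := by
    intro x y hx hy z hz
    obtain ⟨s, t, hs, ht, rfl⟩ := exists_of_rel_mul hz
    exact K.mul_mem (hx hs) (hy ht)
  inv_mem' := fun {x} hx y hy => K.inv_mem_iff.1 (hx (inv_inv x ▸ Rel.inv hy))

theorem core_le (A : SchurRing G) (K : Subgroup G) : A.core K ≤ K := fun x hx =>
  hx (mem_basicSet_self x)

theorem isASet_core (A : SchurRing G) (K : Subgroup G) : A.IsASet (A.core K : Set G) :=
  fun _ _ h hx _ hz => hx (h.trans hz)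

theorem IsASet.subset_core (hV : A.IsASet V) {K : Subgroup G} (hVK : V ⊆ K) : V ⊆ A.core K :=
  fun _ hx _ hy => hVK (hV hy hx)

end SchurRing

end Commutative

theorem ncard_ne_ncard_sdiff_of_odd {α : Type*} {s t : Set α} (ht : Odd t.ncard) (hst : s ⊆ t) :
    s.ncard ≠ (t \ s).ncard := by
  intro heq
  have hcard := Set.ncard_sdiff_add_ncard_of_subset hst (Set.finite_of_ncard_ne_zero ht.pos.ne')
  rw [← heq, ← two_mul] at hcard
  exact Nat.not_even_iff_odd.2 ht ⟨_, hcard.symm.trans (two_mul _)⟩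

theorem two_dvd_ncard_inter_pair_iff {α : Type*} {V : Set α} {u v : α} (huv : u ≠ v) :
    2 ∣ (V ∩ {u, v}).ncard ↔ (u ∈ V ↔ v ∈ V) := by
  by_cases hu : u ∈ V <;> by_cases hv : v ∈ V <;>
    simp [hu, hv, Set.inter_insert_of_mem, Set.inter_insert_of_notMem, Set.ncard_pair huv]

theorem mem_zpowers_iff_of_mul_self {G : Type*} [Group G] {b x : G} (hb : b * b = 1) :
    x ∈ Subgroup.zpowers b ↔ x = 1 ∨ x = b := by
  constructor
  · rintro ⟨i, rfl⟩
    obtain ⟨j, rfl | rfl⟩ := Int.even_or_odd' i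
    · left; simp only [zpow_mul, zpow_two, hb, one_zpow]
    · right; simp only [zpow_add, zpow_mul, zpow_two, hb, one_zpow, one_mul, zpow_one]
  · rintro (rfl | rfl)
    · exact one_mem _
    · exact Subgroup.mem_zpowers x

theorem eq_one_of_mul_self_eq_one {G : Type*} [Group G] {K : Subgroup G} (hK : Odd (Nat.card K))
    {z : G} (hz : z ∈ K) (h : z * z = 1) : z = 1 := by
  have h2 : orderOf z ∣ 2 := orderOf_dvd_of_pow_eq_one (by rw [pow_two, h])
  have hcard : orderOf z ∣ Nat.card K := Subgroup.orderOf_dvd_natCard K hz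
  exact orderOf_eq_one_iff.1 (Nat.eq_one_of_dvd_coprimes (Nat.coprime_two_left.2 hK) h2 hcard)

/-- An inversion-closed set pairs `z` with `z⁻¹`, and only `1` is its own inverse. -/
theorem odd_ncard_iff_one_mem {G : Type*} [Group G] [Finite G] {K : Subgroup G}
    (hK : Odd (Nat.card K)) {Z : Set G} (hZK : Z ⊆ K) (hZ : ∀ z ∈ Z, z⁻¹ ∈ Z) :
    Odd Z.ncard ↔ 1 ∈ Z := by
  classical
  have hsum : ∑ _ ∈ (Z \ {1}).toFinite.toFinset, (1 : ZMod 2) = 0 := by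
    refine Finset.sum_involution (fun z _ => z⁻¹) (fun _ _ => by decide) ?_ ?_ fun z _ => inv_inv z
    · rintro z hz - hzz
      simp only [Set.Finite.mem_toFinset] at hz
      exact hz.2 (eq_one_of_mul_self_eq_one hK (hZK hz.1) (by nth_rw 1 [← hzz]; simp))
    · intro z hz
      simp only [Set.Finite.mem_toFinset] at hz ⊢
      exact ⟨hZ z hz.1, fun h => hz.2 (inv_eq_one.1 h)⟩
  have heven : Even (Z \ {1}).ncard := by
    rwa [Finset.sum_const, nsmul_one, ZMod.natCast_eq_zero_iff, ← Set.ncard_eq_toFinset_card,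
      ← even_iff_two_dvd] at hsum
  by_cases h1 : 1 ∈ Z
  · rw [← Set.ncard_sdiff_singleton_add_one h1]
    exact iff_of_true heven.add_one h1
  · rw [Set.sdiff_singleton_eq_self h1] at heven
    exact iff_of_false (Nat.not_odd_iff_even.2 heven) h1

/-! ### Groups of twice odd order, of index two -/

/-- `H` is, up to isomorphism, the direct product of `H₀`, which has odd order, and the
subgroup of order two generated by `b`, and it has index two in the ambient group. The coset of `H`
through an `e` with `e * e = 1` is then the disjoint union of the cosets of `H₀` through `e` and
`e * b`. -/
structure OddDouble {G : Type*} [Group G] (H₀ H : Subgroup G) (b : G) : Prop where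
  odd_card : Odd (Nat.card H₀)
  le : H₀ ≤ H
  relIndex_eq_two : H₀.relIndex H = 2
  index_eq_two : H.index = 2
  mem : b ∈ H
  notMem : b ∉ H₀
  mul_self : b * b = 1

namespace OddDouble

variable {G : Type*} [CommGroup G] {H₀ H : Subgroup G} {b : G}

theorem mul_mem_iff (S : OddDouble H₀ H b) {x y : G} (hx : x ∈ H) (hy : y ∈ H) :
    x * y ∈ H₀ ↔ (x ∈ H₀ ↔ y ∈ H₀) :=
  Subgroup.mul_mem_iff_of_index_two (H := H₀.subgroupOf H) S.relIndex_eq_two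
    (a := ⟨x, hx⟩) (b := ⟨y, hy⟩)

theorem exists_eq_mul (S : OddDouble H₀ H b) {e g : G} (he : e * e = 1) (hg : g * e ∈ H) :
    ∃ h ∈ H₀, g = h * e ∨ g = h * (e * b) := by
  by_cases hge : g * e ∈ H₀
  · exact ⟨g * e, hge, Or.inl (by rw [mul_assoc, he, mul_one])⟩
  · refine ⟨g * e * b, (S.mul_mem_iff hg S.mem).2 (iff_of_false hge S.notMem), Or.inr ?_⟩
    rw [mul_assoc (g * e), mul_left_comm b e b, S.mul_self, mul_one, mul_assoc, he, mul_one]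

theorem mul_ne_mul (S : OddDouble H₀ H b) {e h k : G} (hh : h ∈ H₀) (hk : k ∈ H₀) :
    h * e ≠ k * (e * b) := by
  intro heq
  rw [mul_left_comm, mul_comm, mul_left_cancel_iff] at heq
  exact S.notMem ((H₀.mul_mem_cancel_left hk).1 (heq ▸ hh))

theorem card_eq (S : OddDouble H₀ H b) : Nat.card G = Nat.card H₀ * 2 ^ 2 := by
  have hH := Subgroup.relIndex_mul_relIndex ⊥ H₀ H bot_le S.le
  rw [Subgroup.relIndex_bot_left, Subgroup.relIndex_bot_left, S.relIndex_eq_two] at hH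
  rw [← H.card_mul_index, S.index_eq_two, ← hH, mul_assoc, ← pow_two]

/-- The exponent `|H₀| + 2` is an admissible multiplier that squares the elements of `H₀` and fixes
the involutions. -/
theorem coprime_card_add_two (S : OddDouble H₀ H b) :
    (Nat.card G).Coprime (Nat.card H₀ + 2) := by
  have hodd : Nat.Coprime 2 (Nat.card H₀) := Nat.coprime_two_left.2 S.odd_card
  rw [S.card_eq, Nat.coprime_mul_iff_left]
  exact ⟨by simpa using hodd.symm, Nat.Coprime.pow_left 2 (by simpa using hodd)⟩

theorem mul_pow_card_add_two (S : OddDouble H₀ H b) {h v : G} (hh : h ∈ H₀) (hv : v * v = 1) :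
    (h * v) ^ (Nat.card H₀ + 2) = h * h * v := by
  obtain ⟨j, hj⟩ := S.odd_card
  have hvj : v ^ (2 * j + 1 + 2) = v := by
    rw [add_assoc, add_comm 1, ← add_assoc, pow_succ, ← Nat.mul_succ, pow_mul, pow_two, hv, one_pow,
      one_mul]
  have hh1 : h ^ Nat.card H₀ = 1 := congrArg Subtype.val (pow_card_eq_one' (x := (⟨h, hh⟩ : H₀)))
  rw [mul_pow, pow_add h, hh1, one_mul, pow_two, hj, hvj]

theorem pow_card_add_two_injective (S : OddDouble H₀ H b) :
    Function.Injective fun g : G => g ^ (Nat.card H₀ + 2) :=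
  (powCoprime S.coprime_card_add_two).injective

theorem pow_card_add_two (S : OddDouble H₀ H b) {h : G} (hh : h ∈ H₀) :
    h ^ (Nat.card H₀ + 2) = h * h := by
  simpa using S.mul_pow_card_add_two hh (mul_one 1)

theorem mul_mul_mul_self (S : OddDouble H₀ H b) {e : G} (he : e * e = 1) : e * b * (e * b) = 1 := by
  rw [mul_mul_mul_comm, he, S.mul_self, mul_one]

theorem exists_sq_eq (S : OddDouble H₀ H b) {e x : G} (he : e * e = 1) (hx : x * e ∈ H) :
    ∃ h ∈ H₀, (x = h * e ∨ x = h * (e * b)) ∧ x ^ 2 = h * h := by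
  obtain ⟨h, hh, hx⟩ := S.exists_eq_mul he hx
  refine ⟨h, hh, hx, ?_⟩
  rcases hx with rfl | rfl
  · rw [pow_two, mul_mul_mul_comm, he, mul_one]
  · rw [pow_two, mul_mul_mul_comm, S.mul_mul_mul_self he, mul_one]

theorem eq_of_mul_self_eq (S : OddDouble H₀ H b) {h k : G} (hh : h ∈ H₀) (hk : k ∈ H₀)
    (heq : h * h = k * k) : h = k :=
  S.pow_card_add_two_injective (by simp only [S.pow_card_add_two hh, S.pow_card_add_two hk, heq])

theorem setOf_sq_eq_mul_self (S : OddDouble H₀ H b) {e h : G} {V : Set G} (he : e * e = 1)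
    (hV : ∀ v ∈ V, v * e ∈ H) (hh : h ∈ H₀) :
    {x | x ∈ V ∧ x ^ 2 = h * h} = V ∩ {h * e, h * (e * b)} := by
  ext x
  refine and_congr_right fun hx => ⟨fun hsq => ?_, ?_⟩
  · obtain ⟨k, hk, hxk, hkk⟩ := S.exists_sq_eq he (hV x hx)
    rwa [S.eq_of_mul_self_eq hk hh (hkk.symm.trans hsq)] at hxk
  · rintro (rfl | rfl)
    · rw [mul_pow, pow_two e, he, mul_one, pow_two]
    · rw [mul_pow, pow_two (e * b), S.mul_mul_mul_self he, mul_one, pow_two]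

theorem eq_one_of_mem_zpowers (S : OddDouble H₀ H b) {x : G} (hx : x ∈ H₀)
    (hxb : x ∈ Subgroup.zpowers b) : x = 1 :=
  ((mem_zpowers_iff_of_mul_self S.mul_self).1 hxb).resolve_right fun h => S.notMem (h ▸ hx)

theorem pow_card_add_two_mem_zpowers_iff (S : OddDouble H₀ H b) {x : G} :
    x ^ (Nat.card H₀ + 2) ∈ Subgroup.zpowers b ↔ x ∈ Subgroup.zpowers b := by
  refine ⟨fun hx => ?_, fun hx => Subgroup.pow_mem _ hx _⟩
  have hfix : (x ^ (Nat.card H₀ + 2)) ^ (Nat.card H₀ + 2) = x ^ (Nat.card H₀ + 2) := by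
    rcases (mem_zpowers_iff_of_mul_self S.mul_self).1 hx with h | h <;> rw [h]
    · rw [one_pow]
    · simpa using S.mul_pow_card_add_two H₀.one_mem S.mul_self
  rwa [S.pow_card_add_two_injective hfix] at hx

theorem eq_of_inv_mul_mem_zpowers (S : OddDouble H₀ H b) {e w w' : G} (hw : w * e ∈ H₀)
    (hw' : w' * e ∈ H₀) (hL : w⁻¹ * w' ∈ Subgroup.zpowers b) : w = w' := by
  have hH₀ := H₀.mul_mem (H₀.inv_mem hw) hw'
  rw [mul_inv, mul_mul_mul_comm, inv_mul_cancel, mul_one] at hH₀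
  exact inv_mul_eq_one.1 (S.eq_one_of_mem_zpowers hH₀ hL)

theorem mul_zpowers_eq_of_mem_rad (S : OddDouble H₀ H b) {e : G} (he : e * e = 1) {V : Set G}
    (hV : ∀ v ∈ V, v * e ∈ H) (hb : b ∈ rad V) :
    {v | v ∈ V ∧ v * e ∈ H₀} * (Subgroup.zpowers b : Set G) = V := by
  have hL : Subgroup.zpowers b ≤ rad V := Subgroup.zpowers_le.2 hb
  ext v
  constructor
  · rintro ⟨w, hw, l, hl, rfl⟩
    change w * l ∈ V
    rw [mul_comm]
    exact mul_mem_of_mem_rad (hL hl) hw.1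
  · intro hv
    obtain ⟨h, hh, rfl | rfl⟩ := S.exists_eq_mul he (hV v hv)
    · exact ⟨h * e, ⟨hv, by rwa [mul_assoc, he, mul_one]⟩, 1, one_mem _, mul_one _⟩
    · have hbv : b * (h * (e * b)) = h * e := by
        rw [mul_comm, mul_assoc, mul_assoc, S.mul_self, mul_one]
      exact ⟨h * e, ⟨hbv ▸ mul_mem_of_mem_rad hb hv, by rwa [mul_assoc, he, mul_one]⟩, b,
        Subgroup.mem_zpowers b, mul_assoc _ _ _⟩

end OddDouble


namespace SchurRing

variable {G : Type*} [CommGroup G] [Finite G] {A : SchurRing G} {H₀ H : Subgroup G}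
  {b e f g h k q r t u w x y z : G} {C V Z : Set G}

theorem mul_mem_of_rel (S : OddDouble H₀ H b) (hH : A.IsASet (H : Set G)) (h : A.Rel x y) :
    x * y ∈ H := by
  rw [Subgroup.mul_mem_iff_of_index_two S.index_eq_two]
  exact hH.mem_iff h

/-! ### Square roots in an `A`-set -/

/-- The elements `h` of `H₀` for which exactly one of `h * e` and `h * (e * b)` lies in `V`. These
are the two square roots of `h * h` in the coset of `e`, so the unpaired `h` are those for which
`h * h` has an odd number of square roots in `V`. -/
def unpaired (H₀ : Subgroup G) (b : G) (V : Set G) (e : G) : Set G :=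
  {h | h ∈ H₀ ∧ ¬(h * e ∈ V ↔ h * (e * b) ∈ V)}

theorem IsASet.unpaired (hV : A.IsASet V) (S : OddDouble H₀ H b) (he : e * e = 1)
    (hVe : ∀ v ∈ V, v * e ∈ H) : A.IsASet (unpaired H₀ b V e) := by
  have hF := hV.setOf_not_dvd_ncard_pow_eq Nat.prime_two
  suffices hmem : ∀ g, g ∈ SchurRing.unpaired H₀ b V e ↔ g ^ (Nat.card H₀ + 2) ∈
      {g | ¬ 2 ∣ {x | x ∈ V ∧ x ^ 2 = g}.ncard} by
    intro x y hxy hx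
    rw [hmem] at hx ⊢
    exact hF (hxy.pow S.coprime_card_add_two) hx
  have hiff : ∀ h ∈ H₀, h ∈ SchurRing.unpaired H₀ b V e ↔ h ^ (Nat.card H₀ + 2) ∈
      {g | ¬ 2 ∣ {x | x ∈ V ∧ x ^ 2 = g}.ncard} := by
    intro h hh
    rw [Set.mem_ofPred_eq, S.pow_card_add_two hh, S.setOf_sq_eq_mul_self he hVe hh,
      two_dvd_ncard_inter_pair_iff (S.mul_ne_mul hh hh)]
    exact and_iff_right hh
  intro g
  by_cases hg : g ∈ H₀
  · exact hiff g hg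
  refine iff_of_false (fun h => hg h.1) fun hodd => hg ?_
  obtain ⟨x, hx⟩ : {x | x ∈ V ∧ x ^ 2 = g ^ (Nat.card H₀ + 2)}.Nonempty := by
    rw [Set.nonempty_iff_ne_empty]
    intro h
    simp [h] at hodd
  obtain ⟨h, hh, -, hsq⟩ := S.exists_sq_eq he (hVe x hx.1)
  exact S.pow_card_add_two_injective ((S.pow_card_add_two hh).trans (hsq.symm.trans hx.2)) ▸ hh

theorem IsASet.mul_mem_iff_of_notMem_core (hV : A.IsASet V) (S : OddDouble H₀ H b)
    (he : e * e = 1) (hVe : ∀ v ∈ V, v * e ∈ H) {h : G} (hh : h ∈ H₀) (hhQ : h ∉ A.core H₀) :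
    h * e ∈ V ↔ h * (e * b) ∈ V := by
  by_contra hpair
  exact hhQ ((hV.unpaired S he hVe).subset_core (fun _ hx => hx.1) ⟨hh, hpair⟩)

theorem IsASet.setOf_mul_mem (hV : A.IsASet V) (S : OddDouble H₀ H b) (he : e * e = 1)
    (hVe : ∀ v ∈ V, v * e ∈ H) (hb : b ∈ SchurRings.rad V) : A.IsASet {g | g * e ∈ V} := by
  set L := Subgroup.zpowers b
  set W : Set G := {v | v ∈ V ∧ v * e ∈ H₀}
  have hWL : W * (L : Set G) = V := S.mul_zpowers_eq_of_mem_rad he hVe hb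
  have hW : ∀ w ∈ W, ∀ w' ∈ W, w⁻¹ * w' ∈ L → w = w' := fun _ hw _ hw' =>
    S.eq_of_inv_mul_mem_zpowers hw.2 hw'.2
  have hfiber : ∀ g, {w | w ∈ W ∧ (w ^ 2)⁻¹ * g ^ (Nat.card H₀ + 2) ∈ L} =
      {w | w ∈ W ∧ w⁻¹ * (g * e) ∈ (L : Set G)} := by
    refine fun g => Set.ext fun w => and_congr_right fun hw => ?_
    have hsq : w ^ 2 = (w * e) ^ (Nat.card H₀ + 2) := by
      rw [S.pow_card_add_two hw.2, mul_mul_mul_comm, he, mul_one, pow_two]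
    have hge : w⁻¹ * (g * e) = (w * e)⁻¹ * g := by
      rw [mul_inv, inv_eq_of_mul_eq_one_left he, mul_comm g, mul_assoc]
    rw [hsq, hge, ← inv_pow, ← mul_pow]
    exact S.pow_card_add_two_mem_zpowers_iff
  have hmem : ∀ g, g * e ∈ V ↔ g ^ (Nat.card H₀ + 2) ∈
      {g | ¬ 2 ∣ {w | w ∈ W ∧ (w ^ 2)⁻¹ * g ∈ L}.ncard} := by
    classical
    intro g
    have hcoeff := coeff_underline_mul W (L : Set G) (g * e)
    rw [← underline_mul_underline_subgroup hW, hWL, coeff_underline, ← hfiber] at hcoeff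
    rw [Set.mem_ofPred_eq, ← Int.natCast_dvd_natCast, ← hcoeff]
    split_ifs with hg <;> simp [hg]
  intro x y hxy hx
  rw [Set.mem_ofPred_eq, hmem] at hx ⊢
  exact (hWL.symm ▸ hV).setOf_not_dvd_ncard_pow_inv_mul_mem hW Nat.prime_two
    (hxy.pow S.coprime_card_add_two) hx

theorem mul_mem_rad_of_rel (hV : A.IsASet V) (S : OddDouble H₀ H b) (he : e * e = 1)
    (hVe : ∀ v ∈ V, v * e ∈ H) (hb : b ∈ SchurRings.rad V) (ht : A.Rel e t) :
    t * e ∈ SchurRings.rad V := by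
  refine mem_rad_iff.2 fun v hv => ?_
  have hmul := forall_mul_mem_of_rel hV (hV.setOf_mul_mem S he hVe hb) ht
    fun y hy => by rwa [mul_comm]
  simpa only [mul_left_comm, mul_comm, mul_assoc] using
    hmul (v * e) (by rwa [Set.mem_ofPred_eq, mul_assoc, he, mul_one])

theorem IsASet.exists_core_or_mem_rad (hV : A.IsASet V) (S : OddDouble H₀ H b) (he : e * e = 1)
    (hVe : ∀ v ∈ V, v * e ∈ H) :
    (∃ q ∈ A.core H₀, q * e ∈ V) ∨ (∃ q ∈ A.core H₀, q * (e * b) ∈ V) ∨ b ∈ SchurRings.rad V := by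
  by_cases hQ : ∃ q ∈ A.core H₀, q * e ∈ V ∨ q * (e * b) ∈ V
  · obtain ⟨q, hq, h | h⟩ := hQ
    · exact Or.inl ⟨q, hq, h⟩
    · exact Or.inr (Or.inl ⟨q, hq, h⟩)
  push Not at hQ
  refine Or.inr (Or.inr (mem_rad_iff.2 fun v hv => ?_))
  obtain ⟨h, hh, rfl | rfl⟩ := S.exists_eq_mul he (hVe v hv)
  · have hhQ : h ∉ A.core H₀ := fun hhQ => (hQ h hhQ).1 hv
    rw [mul_comm, mul_assoc]
    exact (hV.mul_mem_iff_of_notMem_core S he hVe hh hhQ).1 hv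
  · have hhQ : h ∉ A.core H₀ := fun hhQ => (hQ h hhQ).2 hv
    rw [mul_comm, mul_assoc, mul_assoc, S.mul_self, mul_one]
    exact (hV.mul_mem_iff_of_notMem_core S he hVe hh hhQ).2 hv

theorem rel_mul_mem (S : OddDouble H₀ H b) (hH : A.IsASet (H : Set G)) (he : e * e = 1)
    (hx : x * e ∈ H) (h : A.Rel x y) : y * e ∈ H := by
  have hxy := H.mul_mem (mul_mem_of_rel S hH h) (H.inv_mem hx)
  rwa [mul_comm x y, mul_inv, mul_assoc, mul_inv_cancel_left, inv_eq_of_mul_eq_one_left he] at hxy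

/-! ### Separated basic sets of involutions -/

/-- The basic set of `e` avoids the coset through `e * b` of `A.core H₀`. -/
def Separated (A : SchurRing G) (H₀ : Subgroup G) (b e : G) : Prop :=
  ∀ q ∈ A.core H₀, ¬ A.Rel e (q * (e * b))

theorem Rel.of_mul_self (he : e * e = 1) (h : A.Rel e x) : A.Rel e x⁻¹ := by
  simpa only [inv_eq_of_mul_eq_one_left he] using h.inv

theorem odd_ncard_core_mul_mem_basicSet_iff (S : OddDouble H₀ H b) (he : e * e = 1)
    (hf : f * f = 1) : Odd {k | k ∈ A.core H₀ ∧ f * k ∈ A.basicSet e}.ncard ↔ A.Rel e f := by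
  have hodd : Odd (Nat.card (A.core H₀)) :=
    S.odd_card.of_dvd_nat (Subgroup.card_dvd_of_le (A.core_le H₀))
  have hinv : ∀ k ∈ {k | k ∈ A.core H₀ ∧ f * k ∈ A.basicSet e},
      k⁻¹ ∈ {k | k ∈ A.core H₀ ∧ f * k ∈ A.basicSet e} := by
    intro k hk
    have hfk := Rel.of_mul_self he hk.2
    rw [mul_inv, inv_eq_of_mul_eq_one_left hf] at hfk
    exact ⟨inv_mem hk.1, hfk⟩
  rw [odd_ncard_iff_one_mem hodd (fun k hk => hk.1) hinv, Set.mem_ofPred_eq, mul_one]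
  exact and_iff_right (one_mem _)

/-- The basic set of `e` meets the coset of the core through `e` in an odd number of elements, and
the one through `e * b` in an even number. -/
theorem separated_of_not_rel (S : OddDouble H₀ H b) (he : e * e = 1) (hr : ¬ A.Rel e (e * b)) :
    A.Separated H₀ b e := by
  intro q hq hrel
  have hcoset := ncard_eq_of_rel (isASet_basicSet e) (A.isASet_core H₀) hrel
  have hodd := (odd_ncard_core_mul_mem_basicSet_iff (A := A) S he he).2 (Rel.refl e)
  refine hr ((odd_ncard_core_mul_mem_basicSet_iff (A := A) S he (S.mul_mul_mul_self he)).1 ?_)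
  rw [← ncard_setOf_mul_mul_mem hq]
  exact hcoset ▸ hodd

namespace Separated

theorem rel_mul_of_rel (hsep : A.Separated H₀ b e) (S : OddDouble H₀ H b)
    (hH : A.IsASet (H : Set G)) (he : e * e = 1) (hx : x ∈ A.core H₀) (h : A.Rel x y) :
    A.Rel (x * e) (y * e) := by
  have hVe : ∀ v ∈ A.basicSet (x * e), v * e ∈ H := fun v hv => rel_mul_mem S hH he
    (by rw [mul_assoc, he, mul_one]; exact S.le (A.core_le H₀ hx)) hv
  have hnot : ∀ y ∈ A.core H₀, y * (e * b) ∉ A.basicSet (x * e) := by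
    intro y hy hmem
    obtain ⟨u, t, hu, ht, heq⟩ := exists_of_rel_mul hmem
    have hq : u⁻¹ * y ∈ A.core H₀ := mul_mem (inv_mem (A.isASet_core H₀ hu hx)) hy
    exact hsep _ hq (by rwa [mul_assoc, heq, inv_mul_cancel_left])
  have hxU : x ∈ unpaired H₀ b (A.basicSet (x * e)) e :=
    ⟨A.core_le H₀ hx, fun hpair => hnot x hx (hpair.1 (mem_basicSet_self _))⟩
  have hyU := (isASet_basicSet (x * e)).unpaired S he hVe h hxU
  by_contra hye
  exact hyU.2 (iff_of_false hye (hnot y (A.isASet_core H₀ h hx)))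

theorem rel_mul (hsep : A.Separated H₀ b e) (S : OddDouble H₀ H b)
    (hH : A.IsASet (H : Set G)) (he : e * e = 1) (hx : x ∈ A.core H₀) (hxy : A.Rel x y)
    (ht : A.Rel e t) : A.Rel (x * e) (y * t) := by
  obtain ⟨z, hz, htz⟩ := exists_mul_mem_of_rel (isASet_basicSet (y * t)) (isASet_basicSet y) ht.symm
    ⟨y, mem_basicSet_self y, mul_comm y t ▸ mem_basicSet_self _⟩
  have hez : A.Rel (x * e) (z * e) := hsep.rel_mul_of_rel S hH he hx (hxy.trans hz)
  exact hez.trans (mul_comm e z ▸ Rel.symm htz)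

theorem rel_mul_of_rel_mul_self (hsep : A.Separated H₀ b e) (S : OddDouble H₀ H b)
    (hH : A.IsASet (H : Set G)) (he : e * e = 1) (hq : q ∈ A.core H₀) (heq : A.Rel e (q * e))
    (ht : A.Rel e t) : A.Rel e (q * t) :=
  heq.trans (hsep.rel_mul S hH he hq (Rel.refl q) ht)

theorem rel_mul_of_forall (hsep : A.Separated H₀ b e) (S : OddDouble H₀ H b)
    (hH : A.IsASet (H : Set G)) (he : e * e = 1)
    (hr : ∀ h ∈ H₀, A.Rel e (h * f) → A.Rel e (r * h * f)) (hx : x ∈ A.core H₀) (hh : h ∈ H₀)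
    (hrel : A.Rel (x * e) (h * f)) : A.Rel (x * e) (r * h * f) := by
  obtain ⟨y, t, hxy, ht, heq⟩ := exists_of_rel_mul hrel
  have hy : y ∈ H₀ := A.core_le H₀ (A.isASet_core H₀ hxy hx)
  have hte : t = h * y⁻¹ * f := by rw [mul_right_comm, heq, mul_comm y, mul_inv_cancel_right]
  have hrt := hr (h * y⁻¹) (H₀.mul_mem hh (H₀.inv_mem hy)) (hte ▸ ht)
  have hsplit : r * h * f = y * (r * (h * y⁻¹) * f) := by
    rw [← mul_assoc r, mul_right_comm _ y⁻¹ f, mul_comm y, inv_mul_cancel_right]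
  exact hsplit ▸ hsep.rel_mul S hH he hx hxy hrt

end Separated

theorem rel_mul_of_forall_rel (S : OddDouble H₀ H b) (hH : A.IsASet (H : Set G)) (hf : f * f = 1)
    (hfb : ¬ A.Rel f (f * b)) (h₁ : ∀ h ∈ H₀, A.Rel f (h * f) → A.Rel f (r * h * f))
    (h₂ : ∀ h ∈ H₀, A.Rel (f * b) (h * f) → A.Rel (f * b) (r * h * f)) (hh : h ∈ H₀) :
    A.Rel (h * f) (r * h * f) := by
  set V := A.basicSet (h * f)
  have hVf : ∀ v ∈ V, v * f ∈ H := fun v hv => rel_mul_mem S hH hf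
    (by rw [mul_assoc, hf, mul_one]; exact S.le hh) hv
  rcases (isASet_basicSet (h * f)).exists_core_or_mem_rad S hf hVf with
    ⟨q, hq, hqV⟩ | ⟨q, hq, hqV⟩ | hb
  · have hsep := separated_of_not_rel S hf hfb
    exact Rel.trans hqV (hsep.rel_mul_of_forall S hH hf h₁ hq hh (Rel.symm hqV))
  · have hsep : A.Separated H₀ b (f * b) := separated_of_not_rel S (S.mul_mul_mul_self hf)
      (by rw [mul_assoc, S.mul_self, mul_one]; exact fun h => hfb h.symm)
    exact Rel.trans hqV
      (hsep.rel_mul_of_forall S hH (S.mul_mul_mul_self hf) h₂ hq hh (Rel.symm hqV))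
  · have hrf : A.Rel f (r * f) := by
      simpa using h₁ 1 H₀.one_mem (by rw [one_mul]; exact Rel.refl f)
    have hr := mul_mem_rad_of_rel (isASet_basicSet (h * f)) S hf hVf hb hrf
    rw [mul_assoc, hf, mul_one] at hr
    exact mul_assoc r h f ▸ mul_mem_of_mem_rad hr (mem_basicSet_self _)

/-! ### The basic set of `b` -/

/-- The subgroup generated by the basic set of `b`, encoded as the radical of a set which turns out
to be this subgroup itself. -/
def involutionHull (A : SchurRing G) (H₀ : Subgroup G) (b : G) : Subgroup G :=
  rad (A.basicSet b ∪ unpaired H₀ b (A.basicSet b) b)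

theorem mul_mem_of_mem_basicSet_involution (S : OddDouble H₀ H b) (hH : A.IsASet (H : Set G)) :
    ∀ v ∈ A.basicSet b, v * b ∈ H := fun _ =>
  rel_mul_mem S hH S.mul_self (by rw [S.mul_self]; exact H.one_mem)

theorem isASet_unpaired_basicSet (S : OddDouble H₀ H b) (hH : A.IsASet (H : Set G)) :
    A.IsASet (unpaired H₀ b (A.basicSet b) b) :=
  (isASet_basicSet b).unpaired S S.mul_self (mul_mem_of_mem_basicSet_involution S hH)

theorem isASet_involutionHull (S : OddDouble H₀ H b) (hH : A.IsASet (H : Set G)) :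
    A.IsASet (A.involutionHull H₀ b : Set G) :=
  ((isASet_basicSet b).union (isASet_unpaired_basicSet S hH)).rad

theorem mul_mem_basicSet_union_iff (S : OddDouble H₀ H b) (hh : h ∈ H₀) :
    h * b ∈ A.basicSet b ∪ unpaired H₀ b (A.basicSet b) b ↔ A.Rel b (h * b) :=
  or_iff_left fun hu => S.notMem ((H₀.mul_mem_cancel_left hh).1 hu.1)

theorem mem_basicSet_union_iff (S : OddDouble H₀ H b) (hH : A.IsASet (H : Set G)) (hh : h ∈ H₀) :
    h ∈ A.basicSet b ∪ unpaired H₀ b (A.basicSet b) b ↔ A.Rel b (h * b) := by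
  have hpair : h ∈ unpaired H₀ b (A.basicSet b) b ↔
      ¬ (h * b ∈ A.basicSet b ↔ h ∈ A.basicSet b) := by
    rw [unpaired, Set.mem_ofPred_eq, S.mul_self, mul_one, and_iff_right hh]
  have hnot : ¬ (h ∈ A.basicSet b ∧ h ∈ unpaired H₀ b (A.basicSet b) b) := fun ⟨hb, hu⟩ =>
    S.notMem (isASet_unpaired_basicSet S hH (Rel.symm hb) hu).1
  rw [Set.mem_union]
  change _ ↔ h * b ∈ A.basicSet b
  tauto

theorem involution_mem_involutionHull (S : OddDouble H₀ H b) (hH : A.IsASet (H : Set G)) :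
    b ∈ A.involutionHull H₀ b := by
  refine mem_rad_iff.2 fun x hx => ?_
  have hxH : x * b ∈ H := hx.elim (mul_mem_of_mem_basicSet_involution S hH x)
    fun hu => H.mul_mem (S.le hu.1) S.mem
  obtain ⟨h, hh, rfl | rfl⟩ := S.exists_eq_mul S.mul_self hxH
  · rw [mul_comm, mul_assoc, S.mul_self, mul_one]
    exact (mem_basicSet_union_iff S hH hh).2 ((mul_mem_basicSet_union_iff S hh).1 hx)
  · rw [S.mul_self, mul_one] at hx ⊢
    rw [mul_comm]
    exact (mul_mem_basicSet_union_iff S hh).2 ((mem_basicSet_union_iff S hH hh).1 hx)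

theorem rel_mul_of_mem_involutionHull (S : OddDouble H₀ H b) (hu : u ∈ A.involutionHull H₀ b)
    (huH : u ∈ H₀) (hh : h ∈ H₀) (hrel : A.Rel b (h * b)) : A.Rel b (u * h * b) := by
  refine (mul_mem_basicSet_union_iff S (H₀.mul_mem huH hh)).1 ?_
  rw [mul_assoc]
  exact mul_mem_of_mem_rad hu (Or.inl hrel)

theorem involutionHull_le (S : OddDouble H₀ H b) (hH : A.IsASet (H : Set G)) :
    A.involutionHull H₀ b ≤ H := by
  intro u hu
  have hub := mul_mem_of_mem_rad hu (Or.inl (mem_basicSet_self b))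
  refine hub.elim (fun hmem => ?_) fun hmem => ?_
  · exact (H.mul_mem_cancel_right S.mem).1 (hH hmem S.mem)
  · exact (H.mul_mem_cancel_right S.mem).1 (S.le hmem.1)

theorem rel_mul_mul_involution (S : OddDouble H₀ H b) (hH : A.IsASet (H : Set G))
    (hu : u ∈ A.involutionHull H₀ b) (huH : u ∈ H₀) (hx : x ∈ H₀) :
    A.Rel (x * b) (u * x * b) := by
  have hb1 : b * b = 1 := S.mul_self
  refine rel_mul_of_forall_rel S hH hb1 (fun hrel => ?_)
    (fun h hh => rel_mul_of_mem_involutionHull S hu huH hh) (fun h hh hrel => ?_) hx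
  · rw [hb1] at hrel
    have hb : b = 1 := by simpa [basicSet_one] using show b ∈ A.basicSet 1 from hrel.symm
    exact S.notMem (hb ▸ H₀.one_mem)
  · rw [hb1] at hrel
    have hhb : h * b = 1 := by simpa [basicSet_one] using show h * b ∈ A.basicSet 1 from hrel
    exact absurd ((H₀.mul_mem_cancel_left hh).1 (hhb ▸ H₀.one_mem)) S.notMem

theorem basicSet_involution_eq (S : OddDouble H₀ H b) (hH : A.IsASet (H : Set G))
    (hU : A.involutionHull H₀ b ⊓ H₀ = ⊥) : A.basicSet b = {b} := by
  have hbU := involution_mem_involutionHull S hH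
  have htriv : ∀ {h}, h ∈ H₀ → h ∈ A.involutionHull H₀ b → h = 1 := fun hh hhU =>
    (Subgroup.mem_bot).1 (hU ▸ ⟨hhU, hh⟩)
  refine Set.Subset.antisymm (fun x hx => ?_) (by simpa using mem_basicSet_self b)
  have hxU : x ∈ A.involutionHull H₀ b := isASet_involutionHull S hH hx hbU
  obtain ⟨h, hh, rfl | rfl⟩ :=
    S.exists_eq_mul S.mul_self (mul_mem_of_mem_basicSet_involution S hH x hx)
  · rw [htriv hh ((Subgroup.mul_mem_cancel_right _ hbU).1 hxU), one_mul]; rfl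
  · rw [S.mul_self, mul_one] at hx hxU
    have hb : b ∈ A.basicSet 1 := (htriv hh hxU ▸ hx).symm
    rw [basicSet_one, Set.mem_singleton_iff] at hb
    exact absurd (hb ▸ H₀.one_mem) S.notMem

/-- Both sides count solutions `y ∈ Z` of `x * y ∈ Z`, for the related elements `x = b` and
`x = u * b`. Outside `C` every `y` is a solution for `b`, hence also for `u * b`, since
within `C` the solutions for `u * b` embed into those for `b`. -/
theorem mul_mul_mem_of_rel (hZ : A.IsASet Z) (hb : b * b = 1) (hub : A.Rel b (u * b))
    (huC : ∀ y ∈ C, u * y ∈ C) (hbC : ∀ y ∈ C, b * y ∉ C) (hbZ : ∀ y ∈ Z, y ∉ C → b * y ∈ Z)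
    (hy : y ∈ Z) (hyC : y ∉ C) : u * b * y ∈ Z := by
  have hcard := ncard_eq_of_rel hZ hZ hub
  rw [← Set.ncard_inter_add_ncard_sdiff_eq_ncard _ C,
    ← Set.ncard_inter_add_ncard_sdiff_eq_ncard {y | y ∈ Z ∧ u * b * y ∈ Z} C] at hcard
  have hin : ({y | y ∈ Z ∧ u * b * y ∈ Z} ∩ C).ncard ≤ ({y | y ∈ Z ∧ b * y ∈ Z} ∩ C).ncard := by
    refine Set.ncard_le_ncard_of_injOn (u * ·) ?_ (mul_right_injective u).injOn
    rintro x ⟨⟨-, hx⟩, hxC⟩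
    have hbu : b * (u * x) = u * b * x := by rw [← mul_assoc, mul_comm b]
    have hux : b * (u * b * x) ∈ Z := hbZ _ hx (hbu ▸ hbC _ (huC x hxC))
    rw [← hbu, ← mul_assoc, hb, one_mul] at hux
    exact ⟨⟨hux, hbu ▸ hx⟩, huC x hxC⟩
  have hsub : {y | y ∈ Z ∧ u * b * y ∈ Z} \ C ⊆ {y | y ∈ Z ∧ b * y ∈ Z} \ C :=
    fun x hx => ⟨⟨hx.1.1, hbZ x hx.1.1 hx.2⟩, hx.2⟩
  have heq := Set.eq_of_subset_of_ncard_le hsub (by omega)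
  have hmem : y ∈ {y | y ∈ Z ∧ b * y ∈ Z} \ C := ⟨⟨hy, hbZ y hy hyC⟩, hyC⟩
  exact (heq ▸ hmem).1.2

theorem mul_mem_of_mem_basicSet (S : OddDouble H₀ H b) (hH : A.IsASet (H : Set G))
    (he : e * e = 1) : ∀ v ∈ A.basicSet e, v * e ∈ H := fun _ =>
  rel_mul_mem S hH he (by rw [he]; exact H.one_mem)

theorem rel_mul_iff_of_notMem_core (S : OddDouble H₀ H b) (hH : A.IsASet (H : Set G))
    (he : e * e = 1) (hh : h ∈ H₀) (hhQ : h ∉ A.core H₀) :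
    A.Rel e (h * e) ↔ A.Rel e (h * (e * b)) :=
  (isASet_basicSet e).mul_mem_iff_of_notMem_core S he (mul_mem_of_mem_basicSet S hH he) hh hhQ

namespace Separated

theorem not_rel (hsep : A.Separated H₀ b e) : ¬ A.Rel e (e * b) := fun h =>
  hsep 1 (one_mem _) (by rwa [one_mul])

theorem rel_mul_self_of_rel (hsep : A.Separated H₀ b e) (S : OddDouble H₀ H b)
    (hH : A.IsASet (H : Set G)) (he : e * e = 1) (hh : h ∈ H₀) (hrel : A.Rel e (h * (e * b))) :
    A.Rel e (h * e) :=
  (rel_mul_iff_of_notMem_core S hH he hh fun hhQ => hsep h hhQ hrel).2 hrel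

theorem rel_mul_mul_self (hsep : A.Separated H₀ b e) (S : OddDouble H₀ H b)
    (hH : A.IsASet (H : Set G)) (he : e * e = 1) (hu : u ∈ A.involutionHull H₀ b) (huH : u ∈ H₀)
    (hw : w ∈ H₀) (hrel : A.Rel e (w * (e * b))) : A.Rel e (u * w * e) := by
  have hb1 : b * b = 1 := S.mul_self
  have hmul : ∀ k, b * (k * (e * b)) = k * e := fun k => by
    rw [mul_comm b, mul_assoc, mul_assoc e, hb1, mul_one]
  have hub : A.Rel b (u * b) := by
    simpa using rel_mul_of_mem_involutionHull S hu huH H₀.one_mem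
      (by rw [one_mul]; exact Rel.refl b)
  have hmem : u * b * (w * (e * b)) ∈ A.basicSet e := by
    refine mul_mul_mem_of_rel (C := {y | y * e ∈ H₀}) (isASet_basicSet e) hb1 hub ?_ ?_ ?_ hrel ?_
    · exact fun y hy => by simpa only [Set.mem_ofPred_eq, mul_assoc] using H₀.mul_mem huH hy
    · intro y hy hby
      rw [Set.mem_ofPred_eq, mul_assoc] at hby
      exact S.notMem ((H₀.mul_mem_cancel_right hy).1 hby)
    · intro y hy hyC
      obtain ⟨k, hk, rfl | rfl⟩ := S.exists_eq_mul he (mul_mem_of_mem_basicSet S hH he y hy)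
      · exact absurd (by rwa [Set.mem_ofPred_eq, mul_assoc, he, mul_one]) hyC
      · exact hmul k ▸ hsep.rel_mul_self_of_rel S hH he hk hy
    · intro hC
      rw [Set.mem_ofPred_eq, mul_assoc, mul_right_comm, he, one_mul] at hC
      exact S.notMem ((H₀.mul_mem_cancel_left hw).1 hC)
  rwa [mul_assoc, hmul, ← mul_assoc] at hmem

theorem exists_mul_mem_core (hsep : A.Separated H₀ b e) (S : OddDouble H₀ H b)
    (hH : A.IsASet (H : Set G)) (he : e * e = 1) (hw : w ∈ H₀) (hrel : A.Rel e (w * (e * b))) :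
    ∃ u ∈ A.involutionHull H₀ b, u ∈ H₀ ∧ u * w ∈ A.core H₀ ∧ A.Rel e (u * w * e) := by
  by_contra! hcon
  have h₀ : ∀ u ∈ A.involutionHull H₀ b, u ∈ H₀ → A.Rel e (u * w * e) := fun u hu huH =>
    hsep.rel_mul_mul_self S hH he hu huH hw hrel
  have h₁ : ∀ u ∈ A.involutionHull H₀ b, u ∈ H₀ → A.Rel e (u * w * (e * b)) := fun u hu huH =>
    (rel_mul_iff_of_notMem_core S hH he (H₀.mul_mem huH hw)
      fun huQ => hcon u hu huH huQ (h₀ u hu huH)).1 (h₀ u hu huH)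
  have hbU := involution_mem_involutionHull S hH
  have hcoset : ∀ g ∈ (A.involutionHull H₀ b : Set G), w * e * g ∈ A.basicSet e := by
    intro g hg
    have hgb : g * b ∈ H := H.mul_mem (involutionHull_le S hH hg) S.mem
    obtain ⟨v, hv, rfl | rfl⟩ := S.exists_eq_mul S.mul_self hgb
    · have hvb := h₁ v ((Subgroup.mul_mem_cancel_right _ hbU).1 hg) hv
      rwa [mul_comm v, mul_assoc, mul_left_comm v, ← mul_assoc] at hvb
    · rw [S.mul_self, mul_one] at hg ⊢
      exact mul_comm (w * e) v ▸ mul_assoc v w e ▸ h₀ v hg hv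
  have hwe : A.Rel (w * e) e := (hsep.rel_mul_self_of_rel S hH he hw hrel).symm
  exact hsep.not_rel (forall_mul_mem_of_rel (isASet_basicSet e) (isASet_involutionHull S hH) hwe
    hcoset b hbU)

theorem rel_self_mul (hsep : A.Separated H₀ b e) (S : OddDouble H₀ H b)
    (hH : A.IsASet (H : Set G)) (he : e * e = 1) (hw : w ∈ H₀) (hrel : A.Rel e (w * (e * b)))
    (hu : u ∈ A.involutionHull H₀ b) (huH : u ∈ H₀) : A.Rel e (u * e) := by
  obtain ⟨v, hv, hvH, hvQ, hve⟩ := hsep.exists_mul_mem_core S hH he hw hrel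
  have hinv : A.Rel e ((v * w)⁻¹ * e) := by
    simpa only [mul_inv, inv_eq_of_mul_eq_one_left he] using Rel.of_mul_self he hve
  have hv' : A.Rel e (v⁻¹ * (e * b)) := by
    have hmul := hsep.rel_mul_of_rel_mul_self S hH he (inv_mem hvQ) hinv hrel
    rwa [← mul_assoc, mul_inv, mul_assoc v⁻¹, inv_mul_cancel, mul_one] at hmul
  have hmul := hsep.rel_mul_mul_self S hH he (mul_mem hu hv) (H₀.mul_mem huH hvH)
    (H₀.inv_mem hvH) hv'
  rwa [mul_inv_cancel_right] at hmul

theorem rel_mul_of_rel_mul (hsep : A.Separated H₀ b e) (S : OddDouble H₀ H b)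
    (hH : A.IsASet (H : Set G)) (he : e * e = 1) (hw : w ∈ H₀) (hrel : A.Rel e (w * (e * b)))
    (hu : u ∈ A.involutionHull H₀ b) (huH : u ∈ H₀) (hh : h ∈ H₀) (hhe : A.Rel e (h * e)) :
    A.Rel e (u * h * e) := by
  obtain ⟨v, hv, hvH, hvQ, hve⟩ : ∃ v ∈ A.involutionHull H₀ b, v ∈ H₀ ∧ v * h ∈ A.core H₀ ∧
      A.Rel e (v * h * e) := by
    by_cases hhQ : h ∈ A.core H₀
    · exact ⟨1, one_mem _, H₀.one_mem, by rwa [one_mul], by rwa [one_mul]⟩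
    · exact hsep.exists_mul_mem_core S hH he hh ((rel_mul_iff_of_notMem_core S hH he hh hhQ).1 hhe)
  have hmul := hsep.rel_mul_of_rel_mul_self S hH he hvQ hve (hsep.rel_self_mul S hH he hw hrel
    (mul_mem hu (inv_mem hv)) (H₀.mul_mem huH (H₀.inv_mem hvH)))
  rwa [← mul_assoc, mul_comm (v * h), mul_assoc u, inv_mul_cancel_left] at hmul

theorem exists_eq_mul_of_rel (hsep : A.Separated H₀ b e) (S : OddDouble H₀ H b)
    (hH : A.IsASet (H : Set G)) (he : e * e = 1) (hw : w ∈ H₀) (hrel : A.Rel e (w * (e * b)))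
    (hz : A.Rel (e * b) z) : ∃ j ∈ A.core H₀, A.Rel e (j * e) ∧ z = j * (e * b) := by
  have hez : ¬ A.Rel e z := fun h => hsep.not_rel (h.trans hz.symm)
  suffices hk : ∃ k ∈ H₀, A.Rel e (k * e) ∧ (z = k * e ∨ z = k * (e * b)) by
    obtain ⟨k, hk, hke, rfl | rfl⟩ := hk
    · exact absurd hke hez
    · refine ⟨k, ?_, hke, rfl⟩
      by_contra hkQ
      exact hez ((rel_mul_iff_of_notMem_core S hH he hk hkQ).1 hke)
  obtain ⟨y, t, hy, ht, rfl⟩ := exists_of_rel_mul hz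
  have hbU := involution_mem_involutionHull S hH
  have htU : t ∈ A.involutionHull H₀ b := isASet_involutionHull S hH ht hbU
  have htH : t * b ∈ H := H.mul_mem (involutionHull_le S hH htU) S.mem
  have hy' : ∃ h ∈ H₀, A.Rel e (h * e) ∧ (y = h * e ∨ y = h * (e * b)) := by
    obtain ⟨h, hh, rfl | rfl⟩ := S.exists_eq_mul he (mul_mem_of_mem_basicSet S hH he y hy)
    · exact ⟨h, hh, hy, Or.inl rfl⟩
    · exact ⟨h, hh, hsep.rel_mul_self_of_rel S hH he hh hy, Or.inr rfl⟩
  obtain ⟨h, hh, hhe, hyh⟩ := hy'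
  have hmul : ∀ v ∈ A.involutionHull H₀ b, v ∈ H₀ → A.Rel e (v * h * e) := fun v hv hvH =>
    hsep.rel_mul_of_rel_mul S hH he hw hrel hv hvH hh hhe
  obtain ⟨v, hv, rfl | rfl⟩ := S.exists_eq_mul S.mul_self htH
  · have hve := hmul v ((Subgroup.mul_mem_cancel_right _ hbU).1 htU) hv
    refine ⟨v * h, H₀.mul_mem hv hh, hve, ?_⟩
    rcases hyh with rfl | rfl
    · exact Or.inr (by rw [mul_mul_mul_comm, mul_comm h v])
    · exact Or.inl (by rw [mul_mul_mul_comm, mul_assoc e, S.mul_self, mul_one, mul_comm h v])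
  · rw [S.mul_self, mul_one] at htU ⊢
    refine ⟨v * h, H₀.mul_mem hv hh, hmul v htU hv, hyh.imp ?_ ?_⟩ <;> rintro rfl <;>
      rw [mul_comm _ v, mul_assoc]

theorem exists_forall_rel_mul (hsep : A.Separated H₀ b e) (S : OddDouble H₀ H b)
    (hH : A.IsASet (H : Set G)) (he : e * e = 1) (hw : w ∈ H₀) (hrel : A.Rel e (w * (e * b))) :
    ∃ r ∈ H₀, r ≠ 1 ∧ ∀ h ∈ H₀, A.Rel (h * e) (r * h * e) := by
  obtain ⟨u, hu, huH, huQ, -⟩ := hsep.exists_mul_mem_core S hH he hw hrel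
  refine ⟨u, huH, ?_, fun h => rel_mul_of_forall_rel S hH he hsep.not_rel
    (fun k => hsep.rel_mul_of_rel_mul S hH he hw hrel hu huH) fun k hk hbrel => ?_⟩
  · rintro rfl
    exact hsep w (one_mul w ▸ huQ) hrel
  · obtain ⟨j, hj, -, hkj⟩ := hsep.exists_eq_mul_of_rel S hH he hw hrel hbrel
    exact absurd hkj (S.mul_ne_mul hk (A.core_le H₀ hj))

end Separated

theorem exists_mem_core_eq_mul (S : OddDouble H₀ H b) (hH : A.IsASet (H : Set G))
    (he : e * e = 1) (hW : ∀ w ∈ H₀, ¬ A.Rel e (w * (e * b))) (hz : A.Rel e z) :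
    ∃ j ∈ A.core H₀, z = j * e := by
  obtain ⟨j, hj, rfl | rfl⟩ := S.exists_eq_mul he (mul_mem_of_mem_basicSet S hH he z hz)
  · refine ⟨j, ?_, rfl⟩
    by_contra hjQ
    exact hW j hj ((rel_mul_iff_of_notMem_core S hH he hj hjQ).1 hz)
  · exact absurd hz (hW j hj)

theorem exists_forall_rel_mul_of_not_rel (S : OddDouble H₀ H b) (hH : A.IsASet (H : Set G))
    (he : e * e = 1) (heb : ¬ A.Rel e (e * b)) (hne : A.basicSet e ≠ {e}) :
    ∃ r ∈ H₀, r ≠ 1 ∧ ∀ h ∈ H₀, A.Rel (h * e) (r * h * e) := by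
  have hsep := separated_of_not_rel S he heb
  by_cases hW : ∃ w ∈ H₀, A.Rel e (w * (e * b))
  · obtain ⟨w, hw, hwe⟩ := hW
    exact hsep.exists_forall_rel_mul S hH he hw hwe
  push Not at hW
  have heb1 : e * b * (e * b) = 1 := S.mul_mul_mul_self he
  have hebb : e * b * b = e := by rw [mul_assoc, S.mul_self, mul_one]
  have hsep' : A.Separated H₀ b (e * b) :=
    separated_of_not_rel S heb1 (by rw [hebb]; exact fun h => heb h.symm)
  obtain ⟨z, hz, hze⟩ : ∃ z, A.Rel e z ∧ z ≠ e := by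
    by_contra! hcon
    exact hne (Set.Subset.antisymm hcon (by simpa using mem_basicSet_self e))
  obtain ⟨j, hj, rfl⟩ := exists_mem_core_eq_mul S hH he hW hz
  refine ⟨j, A.core_le H₀ hj, fun hj1 => hze (by rw [hj1, one_mul]), fun h =>
    rel_mul_of_forall_rel S hH he heb (fun k _ hk => ?_) fun k hk hrel => ?_⟩
  · exact mul_assoc j k e ▸ hsep.rel_mul_of_rel_mul_self S hH he hj hz hk
  have hk' : A.Rel (e * b) (k * (e * b * b)) := by rwa [hebb]
  obtain ⟨j', hj', hje, heq⟩ := hsep'.exists_eq_mul_of_rel S hH heb1 hk hk'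
    (z := j * e) (by rwa [hebb])
  rw [hebb] at heq
  rw [mul_right_cancel heq, mul_assoc]
  exact hsep'.rel_mul_of_rel_mul_self S hH heb1 hj' hje hrel

/-! ### Singleton basic sets -/

theorem rel_mul_right (hg : A.basicSet g = {g}) (h : A.Rel x y) : A.Rel (x * g) (y * g) := by
  obtain ⟨t, ht, hyt⟩ := exists_mul_mem_of_rel (isASet_basicSet (x * g)) (isASet_basicSet g) h
    ⟨g, mem_basicSet_self g, mem_basicSet_self _⟩
  rw [hg] at ht
  exact (ht : t = g) ▸ hyt

theorem mem_rad_basicSet_of_rel_mul (hg : A.basicSet g = {g}) (h : A.Rel x (x * g)) :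
    g ∈ SchurRings.rad (A.basicSet x) :=
  mem_rad_iff.2 fun v hv => mul_comm v g ▸ Rel.trans h (rel_mul_right hg hv)

theorem isASet_union_mul_preimage (hg : A.basicSet g = {g}) (hV : A.IsASet V) :
    A.IsASet {x | x ∈ V ∨ x * g ∈ V} :=
  fun _ _ hxy => Or.imp (@hV _ _ hxy) (@hV _ _ (rel_mul_right hg hxy))

theorem mul_mem_unpaired (S : OddDouble H₀ H b) (he : e * e = 1)
    (hb : A.basicSet b = {b}) (hV : A.IsASet V) (hVe : ∀ v ∈ V, v * e ∈ H)
    (hVb : ∀ v ∈ V, v * b ∉ V) (hk : k ∈ H₀) (hke : A.Rel e (k * e)) (hh : h ∈ H₀)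
    (hhV : h * e ∈ V ∨ h * e * b ∈ V) : k * h ∈ unpaired H₀ b V e := by
  have hbb : ∀ v, v * b * b = v := fun v => by rw [mul_assoc, S.mul_self, mul_one]
  have hYe : ∀ v ∈ {x | x ∈ V ∨ x * b ∈ V}, v * e ∈ H := fun v hv => hv.elim (hVe v) fun hvb =>
    (H.mul_mem_cancel_right S.mem).1 (mul_right_comm v b e ▸ hVe _ hvb)
  have hbY : b ∈ SchurRings.rad {x | x ∈ V ∨ x * b ∈ V} := mem_rad_iff.2 fun v hv => by
    rw [Set.mem_ofPred_eq, mul_comm, hbb]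
    exact Or.symm hv
  have hkY := mul_mem_rad_of_rel (isASet_union_mul_preimage hb hV) S he hYe hbY hke
  rw [mul_assoc, he, mul_one] at hkY
  have hkh : k * h * e ∈ {x | x ∈ V ∨ x * b ∈ V} := mul_assoc k h e ▸ mul_mem_of_mem_rad hkY hhV
  refine ⟨H₀.mul_mem hk hh, fun hpair => ?_⟩
  rw [← mul_assoc (k * h)] at hpair
  exact hkh.elim (fun hmem => hVb _ hmem (hpair.1 hmem)) fun hmem => hVb _ (hpair.2 hmem) hmem

/-- If `k * h * e` were not in the basic set of `h * e`, then `k * h * (e * b)` would be. The coset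
of the odd-order `A`-subgroup `K` through `h * e` then meets that basic set in as many points as
the one through `h * (e * b)`, but the two intersections correspond to complementary subsets
of `K`. -/
theorem rel_mul_of_forall_mul_notMem (S : OddDouble H₀ H b) (hH : A.IsASet (H : Set G))
    (he : e * e = 1) (hb : A.basicSet b = {b}) (heb : b ∈ SchurRings.rad (A.basicSet e))
    (hk : k ∈ H₀) (hke : A.Rel e (k * e)) (hh : h ∈ H₀)
    (hVb : ∀ v ∈ A.basicSet (h * e), v * b ∉ A.basicSet (h * e)) : A.Rel (h * e) (k * h * e) := by
  set V := A.basicSet (h * e)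
  have hVe : ∀ v ∈ V, v * e ∈ H := fun v => rel_mul_mem S hH he
    (by rw [mul_assoc, he, mul_one]; exact S.le hh)
  have hunp : ∀ x ∈ H₀, A.Rel e (x * e) → x * h ∈ unpaired H₀ b V e := fun x hx hxe =>
    mul_mem_unpaired S he hb (isASet_basicSet _) hVe hVb hx hxe hh (Or.inl (mem_basicSet_self _))
  have hcore : ∀ x ∈ H₀, A.Rel e (x * e) → x * h ∈ A.core H₀ := fun x hx hxe =>
    ((isASet_basicSet _).unpaired S he hVe).subset_core (fun _ hy => hy.1) (hunp x hx hxe)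
  have hhQ : h ∈ A.core H₀ := by
    simpa only [one_mul] using hcore 1 H₀.one_mem (by rw [one_mul]; exact Rel.refl e)
  set K := SchurRings.rad (A.basicSet e) ⊓ A.core H₀
  have hKe : ∀ x ∈ K, A.Rel e (x * e) := fun x hx => mul_mem_of_mem_rad hx.1 (mem_basicSet_self e)
  have hkK : k ∈ K := by
    refine ⟨?_, (Subgroup.mul_mem_cancel_right _ hhQ).1 (hcore k hk hke)⟩
    have hrad := mul_mem_rad_of_rel (isASet_basicSet e) S he (mul_mem_of_mem_basicSet S hH he)
      heb hke
    rwa [mul_assoc, he, mul_one] at hrad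
  have hKA : A.IsASet (K : Set G) := (isASet_basicSet e).rad.inter (A.isASet_core H₀)
  by_contra hn
  have hkb : A.Rel (h * e) (k * (h * (e * b))) := by
    by_contra hn'
    exact (hunp k hk hke).2 (iff_of_false hn (mul_assoc k h (e * b) ▸ hn'))
  have hhalf : {y | y ∈ K ∧ h * e * y ∈ V}.ncard = {y | y ∈ K ∧ h * (e * b) * y ∈ V}.ncard :=
    (ncard_eq_of_rel (isASet_basicSet _) hKA hkb).trans (ncard_setOf_mul_mul_mem hkK _ _)
  have hcompl : {y | y ∈ K ∧ h * (e * b) * y ∈ V} = (K : Set G) \ {y | y ∈ K ∧ h * e * y ∈ V} := by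
    ext y
    refine and_congr_right fun hy => ?_
    have hpair := (hunp y (A.core_le H₀ hy.2) (hKe y hy)).2
    rw [mul_comm y, mul_right_comm, mul_right_comm h y (e * b)] at hpair
    change _ ↔ ¬ (y ∈ K ∧ h * e * y ∈ V)
    tauto
  have hodd : Odd (Nat.card K) :=
    S.odd_card.of_dvd_nat (Subgroup.card_dvd_of_le (inf_le_right.trans (A.core_le H₀)))
  exact ncard_ne_ncard_sdiff_of_odd hodd (fun y hy => hy.1) (hcompl ▸ hhalf)

theorem rel_mul_of_basicSet_eq_singleton (S : OddDouble H₀ H b) (hH : A.IsASet (H : Set G))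
    (he : e * e = 1) (hb : A.basicSet b = {b}) (heb : A.Rel e (e * b)) (hk : k ∈ H₀)
    (hke : A.Rel e (k * e)) (hh : h ∈ H₀) : A.Rel (h * e) (k * h * e) := by
  by_cases hVb : ∃ v ∈ A.basicSet (h * e), v * b ∈ A.basicSet (h * e)
  · obtain ⟨v, hv, hvb⟩ := hVb
    have hbrad : b ∈ SchurRings.rad (A.basicSet (h * e)) :=
      mem_rad_basicSet_of_rel_mul hb (Rel.trans hvb (rel_mul_right hb (Rel.symm hv)))
    have hk := mul_mem_rad_of_rel (isASet_basicSet _) S he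
      (fun v => rel_mul_mem S hH he (by rw [mul_assoc, he, mul_one]; exact S.le hh)) hbrad hke
    rw [mul_assoc, he, mul_one] at hk
    exact mul_assoc k h e ▸ mul_mem_of_mem_rad hk (mem_basicSet_self _)
  · push Not at hVb
    exact rel_mul_of_forall_mul_notMem S hH he hb (mem_rad_basicSet_of_rel_mul hb heb) hk hke hh hVb

theorem exists_forall_rel_mul_of_basicSet_eq_singleton (S : OddDouble H₀ H b)
    (hH : A.IsASet (H : Set G)) (he : e * e = 1) (hb : A.basicSet b = {b})
    (heb : A.Rel e (e * b)) (hne : A.basicSet e ≠ {e, e * b}) :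
    ∃ r ∈ H₀, r ≠ 1 ∧ ∀ h ∈ H₀, A.Rel (h * e) (r * h * e) := by
  suffices hk : ∃ k ∈ H₀, k ≠ 1 ∧ A.Rel e (k * e) by
    obtain ⟨k, hk, hk1, hke⟩ := hk
    exact ⟨k, hk, hk1, fun h => rel_mul_of_basicSet_eq_singleton S hH he hb heb hk hke⟩
  by_contra! hcon
  refine hne (Set.Subset.antisymm (fun z hz => ?_) (Set.pair_subset (Rel.refl e) heb))
  obtain ⟨h, hh, rfl | rfl⟩ := S.exists_eq_mul he (mul_mem_of_mem_basicSet S hH he z hz)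
  · exact Or.inl (by rw [not_imp_not.1 (hcon h hh) hz, one_mul])
  · have hhe := mul_mem_of_mem_rad (mem_rad_basicSet_of_rel_mul hb heb) hz
    rw [mul_left_comm, mul_comm b, mul_assoc e, S.mul_self, mul_one] at hhe
    exact Or.inr (by rw [not_imp_not.1 (hcon h hh) hhe, one_mul]; rfl)

end SchurRing

/-! ### Layers -/

/-- The `m`-torsion subgroup, consisting of the `x` with `x ^ m = 1`. -/
def torsionSubgroup (G : Type*) [CommGroup G] (m : ℕ) : Subgroup G :=
  (powMonoidHom m : G →* G).ker

/-- The exponent cutting out `layer G p k`. The power of an element by it depends only on the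
`p`-part of the element. -/
noncomputable def layerExponent (G : Type*) (p k : ℕ) : ℕ :=
  ordCompl[p] (Nat.card G) * p ^ k

theorem coprime_layerExponent_mul_add_one {G : Type*} {p k i : ℕ} :
    (Nat.card G).Coprime (layerExponent G p (k + 1) * i + 1) := by
  refine Nat.coprime_of_dvd fun q hq hqG hqm => hq.one_lt.ne' (Nat.dvd_one.1 ?_)
  have hqE : q ∣ layerExponent G p (k + 1) := by
    rw [← Nat.ordProj_mul_ordCompl_eq_self (Nat.card G) p, hq.dvd_mul] at hqG
    exact hqG.elim (fun h => (dvd_pow (hq.dvd_of_dvd_pow h) k.succ_ne_zero).mul_left _)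
      fun h => h.mul_right _
  exact (Nat.dvd_add_right (hqE.mul_right i)).1 hqm

/-- The product of the Hall `p'`-subgroup of `G` and the `p ^ k`-torsion. The layers filter `G` by
the order of the `p`-part of an element. -/
noncomputable def layer (G : Type*) [CommGroup G] (p k : ℕ) : Subgroup G :=
  torsionSubgroup G (layerExponent G p k)

section Layer

variable {G : Type*} [CommGroup G] {p i j k m : ℕ} {l t x y z : G} {V : Set G}

theorem mem_torsionSubgroup : x ∈ torsionSubgroup G m ↔ x ^ m = 1 := Iff.rfl

theorem mem_layer : x ∈ layer G p k ↔ x ^ layerExponent G p k = 1 := Iff.rfl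

theorem layer_mono (hij : i ≤ j) : layer G p i ≤ layer G p j := fun _ hx =>
  orderOf_dvd_iff_pow_eq_one.1
    ((orderOf_dvd_of_pow_eq_one hx).trans (Nat.mul_dvd_mul_left _ (pow_dvd_pow p hij)))

theorem torsionSubgroup_le_layer : torsionSubgroup G p ≤ layer G p (k + 1) := fun _ hx => by
  rw [mem_layer, layerExponent, pow_succ', mul_left_comm, pow_mul,
    mem_torsionSubgroup.1 hx, one_pow]

theorem pow_layerExponent_mem (hx : x ∈ layer G p (k + 1)) :
    x ^ layerExponent G p k ∈ torsionSubgroup G p := by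
  rwa [mem_torsionSubgroup, ← pow_mul, layerExponent, mul_assoc, ← pow_succ]

theorem pow_mem_layer (hx : x ∈ layer G p (k + 1)) : x ^ p ∈ layer G p k := by
  rwa [mem_layer, ← pow_mul, mul_comm, layerExponent, mul_assoc, ← pow_succ]

theorem mem_layer_of_pow_eq_one (hm : m.Coprime p) (hx : x ^ m = 1) : x ∈ layer G p k := by
  refine layer_mono (Nat.zero_le k) (mem_layer.2 (orderOf_dvd_iff_pow_eq_one.1 ?_))
  have hcop : (orderOf x).Coprime (ordProj[p] (Nat.card G)) :=
    (hm.coprime_dvd_left (orderOf_dvd_of_pow_eq_one hx)).pow_right _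
  rw [layerExponent, pow_zero, mul_one]
  refine hcop.dvd_of_dvd_mul_left ?_
  rw [Nat.ordProj_mul_ordCompl_eq_self]
  exact orderOf_dvd_natCard x

theorem exists_notMem_layer (hx : x ∉ layer G p k) :
    ∃ j ≥ k, x ∉ layer G p j ∧ x ∈ layer G p (j + 1) := by
  by_contra! h
  have hnot : ∀ j ≥ k, x ∉ layer G p j := fun j hj =>
    Nat.le_induction hx (fun j hj ih => h j hj ih) j hj
  refine hnot (max k ((Nat.card G).factorization p)) (le_max_left _ _)
    (layer_mono (le_max_right _ _) ?_)
  rw [mem_layer, layerExponent, mul_comm, Nat.ordProj_mul_ordCompl_eq_self]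
  exact pow_card_eq_one'

theorem eq_one_of_mem_layer_zero [Finite G] (hp : p.Prime) (hl : l ∈ torsionSubgroup G p)
    (h : l ∈ layer G p 0) : l = 1 := by
  rw [mem_layer, layerExponent, pow_zero, mul_one] at h
  exact orderOf_eq_one_iff.1 (Nat.eq_one_of_dvd_coprimes (Nat.coprime_ordCompl hp Nat.card_pos.ne')
    (orderOf_dvd_of_pow_eq_one hl) (orderOf_dvd_of_pow_eq_one h))

theorem exists_pow_eq_of_mem (hp : p.Prime) (hP : Nat.card (torsionSubgroup G p) = p)
    (ht : t ∈ torsionSubgroup G p) (ht1 : t ≠ 1) (hl : l ∈ torsionSubgroup G p) :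
    ∃ i : ℕ, t ^ i = l := by
  have := Fact.mk hp
  obtain ⟨i, hi⟩ := mem_powers_of_prime_card (g := (⟨t, ht⟩ : torsionSubgroup G p)) (g' := ⟨l, hl⟩)
    hP (fun h => ht1 (congrArg Subtype.val h))
  exact ⟨i, congrArg Subtype.val hi⟩

theorem exists_ne_one_of_card_eq_prime {K : Subgroup G} (hp : p.Prime) (hK : Nat.card K = p) :
    ∃ l ∈ K, l ≠ 1 :=
  K.bot_or_exists_ne_one.resolve_left fun h => hp.one_lt.ne (Subgroup.card_eq_one.2 h ▸ hK)

theorem dvd_ncard_setOf_pow_eq_iff (hp : p.Prime) (hP : Nat.card (torsionSubgroup G p) = p)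
    (hx : x ∈ V) :
    p ∣ {y | y ∈ V ∧ y ^ p = x ^ p}.ncard ↔ ∀ l ∈ torsionSubgroup G p, l * x ∈ V := by
  have hfib : {y | y ∈ V ∧ y ^ p = x ^ p} =
      (· * x) '' {l | l ∈ torsionSubgroup G p ∧ l * x ∈ V} := by
    ext y
    constructor
    · rintro ⟨hy, hyx⟩
      refine ⟨y * x⁻¹, ⟨?_, by rwa [inv_mul_cancel_right]⟩, inv_mul_cancel_right y x⟩
      rw [mem_torsionSubgroup, mul_pow, hyx, inv_pow, mul_inv_cancel]
    · rintro ⟨l, ⟨hl, hlx⟩, rfl⟩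
      exact ⟨hlx, by simp only [mul_pow, mem_torsionSubgroup.1 hl, one_mul]⟩
  have hfin : (torsionSubgroup G p : Set G).Finite :=
    Nat.finite_of_card_ne_zero (hP.trans_ne hp.ne_zero)
  have hcard : (torsionSubgroup G p : Set G).ncard = p := hP
  have hsub : {l | l ∈ torsionSubgroup G p ∧ l * x ∈ V} ⊆ torsionSubgroup G p := fun _ h => h.1
  rw [hfib, Set.ncard_image_of_injective _ (mul_left_injective x)]
  constructor
  · intro hdvd l hl
    have hpos : 0 < {l | l ∈ torsionSubgroup G p ∧ l * x ∈ V}.ncard :=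
      (Set.ncard_pos (hfin.subset hsub)).2 ⟨1, one_mem _, by rwa [one_mul]⟩
    have heq := Set.eq_of_subset_of_ncard_le hsub (hcard.trans_le (Nat.le_of_dvd hpos hdvd)) hfin
    exact (heq.ge hl).2
  · intro hall
    rw [hsub.antisymm fun l hl => ⟨hl, hall l hl⟩, hcard]

end Layer

namespace SchurRing

variable {G : Type*} [CommGroup G] [Finite G] {A : SchurRing G} {H₀ H L : Subgroup G} {b e : G}
  {N : Set G} {p k : ℕ} {r s u x y z : G}

theorem Rel.pow_layerExponent_mul (h : A.Rel x y) (p k i : ℕ) :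
    A.Rel ((x ^ layerExponent G p (k + 1)) ^ i * x) ((y ^ layerExponent G p (k + 1)) ^ i * y) := by
  simpa only [pow_succ, pow_mul] using h.pow (m := layerExponent G p (k + 1) * i + 1)
    coprime_layerExponent_mul_add_one

theorem Rel.mul_of_mem_layer (hp : p.Prime) (hP : Nat.card (torsionSubgroup G p) = p)
    (h : A.Rel z y) (hy : y ∈ layer G p (k + 1)) (hz : z ∉ layer G p (k + 1)) :
    ∀ l ∈ torsionSubgroup G p, A.Rel z (l * z) := by
  intro l hl
  obtain ⟨_ | j, hj, hzj, hzj'⟩ := exists_notMem_layer hz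
  · omega
  obtain ⟨i, rfl⟩ := exists_pow_eq_of_mem hp hP (pow_layerExponent_mem hzj') hzj hl
  have hpow := h.pow_layerExponent_mul p j i
  rw [mem_layer.1 (layer_mono hj hy), one_pow, one_mul] at hpow
  exact h.trans hpow.symm

theorem Rel.mul_mul_of_notMem_layer (hp : p.Prime) (hP : Nat.card (torsionSubgroup G p) = p)
    (hz : z ∉ layer G p (k + 1)) (hz' : z ∈ layer G p (k + 2)) (hs : s ∈ torsionSubgroup G p)
    (hr : r ∈ torsionSubgroup G p) (h : A.Rel z (s * z)) : A.Rel (r * z) (r * s * z) := by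
  obtain ⟨i, rfl⟩ := exists_pow_eq_of_mem hp hP (pow_layerExponent_mem hz') hz hr
  have hpow := h.pow_layerExponent_mul p k i
  rwa [mul_pow, mem_layer.1 (torsionSubgroup_le_layer hs), one_mul, ← mul_assoc] at hpow

theorem Rel.mul_of_rel_mul (hp : p.Prime) (hP : Nat.card (torsionSubgroup G p) = p)
    (h : A.Rel z y) (hy : y ∉ layer G p (k + 1)) (hy' : y ∈ layer G p (k + 2))
    (hz : z ∉ layer G p (k + 1)) (hz' : z ∈ layer G p (k + 2)) (hs : s ∈ torsionSubgroup G p)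
    (hs1 : s ≠ 1) (hys : A.Rel y (s * y)) : ∀ l ∈ torsionSubgroup G p, A.Rel z (l * z) := by
  have hyP := pow_layerExponent_mem hy'
  have hzP := pow_layerExponent_mem hz'
  obtain ⟨i, rfl⟩ := exists_pow_eq_of_mem hp hP hyP hy hs
  set t := (z ^ layerExponent G p (k + 1)) ^ i
  have htP : t ∈ torsionSubgroup G p := Subgroup.pow_mem _ hzP i
  have hzt : A.Rel z (t * z) := (h.trans hys).trans (h.pow_layerExponent_mul p k i).symm
  have ht1 : t ≠ 1 := by
    intro h1
    obtain ⟨j, rfl⟩ : p ∣ i := orderOf_eq_prime (hp := ⟨hp⟩) hzP hz ▸ orderOf_dvd_of_pow_eq_one h1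
    exact hs1 (by rw [pow_mul, mem_torsionSubgroup.1 hyP, one_pow])
  intro l hl
  obtain ⟨j, rfl⟩ := exists_pow_eq_of_mem hp hP htP ht1 hl
  induction j with
  | zero => simpa using Rel.refl z
  | succ j ih =>
    rw [pow_succ']
    exact hzt.trans (.mul_mul_of_notMem_layer hp hP hz hz' (Subgroup.pow_mem _ htP j) htP
      (ih (Subgroup.pow_mem _ htP j)))

theorem IsASet.eq_empty_of_subset (hN : A.IsASet N) (S : OddDouble H₀ H b)
    (hH : A.IsASet (H : Set G)) (he : e * e = 1) (heb : A.Rel e (e * b))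
    (hNe : ∀ v ∈ N, v * e ∈ H) (hNL : N ⊆ L) (hu : u ∈ A.involutionHull H₀ b) (huH : u ∈ H₀)
    (huL : u ∉ L) : N = ∅ := by
  have hnot : ∀ x ∈ H₀, ∀ y ∈ H₀, x * e ∈ N → y * (e * b) ∉ N := by
    intro x hx y hy hxN hyN
    have hxy : x * y * b ∈ N * N := ⟨x * e, hxN, y * (e * b), hyN, by
      change x * e * (y * (e * b)) = x * y * b
      rw [mul_mul_mul_comm, ← mul_assoc e, he, one_mul]⟩
    have huxy : u * (x * y) * b ∈ N * N :=
      (hN.mul hN) (rel_mul_mul_involution S hH hu huH (H₀.mul_mem hx hy)) hxy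
    have hsub : N * N ⊆ L := by
      rintro _ ⟨v, hv, w, hw, rfl⟩
      exact L.mul_mem (hNL hv) (hNL hw)
    exact huL ((L.mul_mem_cancel_right (hsub hxy)).1
      (by simpa only [mul_assoc, SetLike.mem_coe] using hsub huxy))
  have hD := hN.unpaired S he hNe
  refine Set.eq_empty_of_forall_notMem fun v hv => ?_
  obtain ⟨x, hx, rfl | rfl⟩ := S.exists_eq_mul he (hNe v hv)
  · obtain ⟨y, hy, hyN⟩ := exists_mul_mem_of_rel hN hD heb
      ⟨x, ⟨hx, fun h => hnot x hx x hx hv (h.1 hv)⟩, mul_comm x e ▸ hv⟩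
    exact hnot x hx y hy.1 hv (mul_comm (e * b) y ▸ hyN)
  · obtain ⟨y, hy, hyN⟩ := exists_mul_mem_of_rel hN hD heb.symm
      ⟨x, ⟨hx, fun h => hnot x hx x hx (h.2 hv) hv⟩, mul_comm x (e * b) ▸ hv⟩
    exact hnot y hy.1 x hx (mul_comm e y ▸ hyN) hv

theorem rel_mul_of_forall_notMem_layer (S : OddDouble H₀ H b) (hH : A.IsASet (H : Set G))
    (he : e * e = 1) (heb : A.Rel e (e * b)) (hp : p.Prime) (hp2 : Odd p)
    (hP : Nat.card (torsionSubgroup G p) = p)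
    (hPU : torsionSubgroup G p ≤ A.involutionHull H₀ b ⊓ H₀) (hz : z * e ∈ H)
    (hfull : ∀ y, A.Rel z y → y ∉ layer G p 1 → ∀ l ∈ torsionSubgroup G p, A.Rel y (l * y)) :
    ∀ l ∈ torsionSubgroup G p, A.Rel z (l * z) := by
  set V := A.basicSet z
  set N : Set G := {g | ¬ p ∣ {x | x ∈ V ∧ x ^ p = g}.ncard} with hNdef
  have hN : A.IsASet N := (isASet_basicSet z).setOf_not_dvd_ncard_pow_eq hp
  have hNmem : ∀ g ∈ N, ∃ x ∈ V, x ^ p = g ∧ x ∈ layer G p 1 := by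
    intro g hg
    obtain ⟨x, hx, rfl⟩ : {x | x ∈ V ∧ x ^ p = g}.Nonempty := by
      by_contra! h
      simp [hNdef, h] at hg
    refine ⟨x, hx, rfl, by_contra fun hx1 => hg ?_⟩
    exact (dvd_ncard_setOf_pow_eq_iff hp hP hx).2 fun l hl => Rel.trans hx (hfull x hx hx1 l hl)
  have hNe : ∀ g ∈ N, g * e ∈ H := by
    intro g hg
    obtain ⟨x, hx, rfl, -⟩ := hNmem g hg
    obtain ⟨j, rfl⟩ := hp2
    have hep : e ^ (2 * j + 1) = e := by rw [pow_succ, pow_mul, pow_two, he, one_pow, one_mul]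
    have hxe := H.pow_mem (rel_mul_mem S hH he hz hx) (2 * j + 1)
    rwa [mul_pow, hep] at hxe
  have hNL : N ⊆ layer G p 0 := by
    intro g hg
    obtain ⟨x, -, rfl, hx1⟩ := hNmem g hg
    exact pow_mem_layer hx1
  obtain ⟨u, hu, hu1⟩ := exists_ne_one_of_card_eq_prime hp hP
  have hempty : N = ∅ := hN.eq_empty_of_subset S hH he heb hNe hNL (hPU hu).1 (hPU hu).2
    fun huL => hu1 (eq_one_of_mem_layer_zero hp hu huL)
  refine (dvd_ncard_setOf_pow_eq_iff hp hP (mem_basicSet_self z)).1 (by_contra fun hdvd => ?_)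
  exact (hempty ▸ hdvd : z ^ p ∈ (∅ : Set G))

end SchurRing

/-! ### Sets that are split by a subgroup -/

/-- The set `V` has at most one point in each coset of `P` inside `L` and is a union of cosets of
`P` outside `L`. -/
structure SplitsOver {G : Type*} [Group G] (V : Set G) (P L : Subgroup G) : Prop where
  le : P ≤ L
  eq_one : ∀ v ∈ V, v ∈ L → ∀ l ∈ P, l * v ∈ V → l = 1
  mul_mem : ∀ v ∈ V, v ∉ L → ∀ l ∈ P, l * v ∈ V

theorem SplitsOver.mul_mem_iff {G : Type*} [Group G] {V : Set G} {P L : Subgroup G} {l v : G}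
    (hVP : SplitsOver V P L) (hl : l ∈ P) (hv : v ∉ L) : l * v ∈ V ↔ v ∈ V := by
  refine ⟨fun h => ?_, fun h => hVP.mul_mem v h hv l hl⟩
  have hlv : l * v ∉ L := fun h => hv ((L.mul_mem_cancel_left (hVP.le hl)).1 h)
  simpa using hVP.mul_mem _ h hlv l⁻¹ (P.inv_mem hl)

theorem SplitsOver.mul_mem_unpaired {G : Type*} [CommGroup G] {V : Set G} {H₀ P L : Subgroup G}
    {b e l y : G} (hVP : SplitsOver V P L) (heL : e ∈ L) (hbL : b ∈ L) (hl : l ∈ P) (hlH : l ∈ H₀)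
    (hl1 : l ≠ 1) (hy : y ∈ SchurRing.unpaired H₀ b V e) (hly : l * y * e ∈ V) :
    l * y ∈ SchurRing.unpaired H₀ b V e := by
  refine ⟨H₀.mul_mem hlH hy.1, ?_⟩
  rw [mul_assoc] at hly
  by_cases hyL : y ∈ L
  · have hye : y * e ∉ V := fun h => hl1 (hVP.eq_one _ h (L.mul_mem hyL heL) l hl hly)
    have hyeb : y * (e * b) ∈ V := by
      by_contra hn
      exact hy.2 (iff_of_false hye hn)
    intro hpair
    rw [mul_assoc, mul_assoc] at hpair
    exact hl1 (hVP.eq_one _ hyeb (L.mul_mem hyL (L.mul_mem heL hbL)) l hl (hpair.1 hly))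
  · rw [mul_assoc, mul_assoc, hVP.mul_mem_iff hl ((L.mul_mem_cancel_right heL).not.2 hyL),
      hVP.mul_mem_iff hl ((L.mul_mem_cancel_right (L.mul_mem heL hbL)).not.2 hyL)]
    exact hy.2

namespace SchurRing

variable {G : Type*} [CommGroup G] [Finite G] {A : SchurRing G} {H₀ H P L : Subgroup G} {b e : G}
  {V : Set G} {l x : G}

theorem splitsOver_basicSet {p k : ℕ} {y : G} (hp : p.Prime)
    (hP : Nat.card (torsionSubgroup G p) = p) (hy : y ∉ layer G p (k + 1))
    (hy' : y ∈ layer G p (k + 2)) (hl : l ∈ torsionSubgroup G p) (hly : ¬ A.Rel y (l * y)) :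
    SplitsOver (A.basicSet y) (torsionSubgroup G p) (layer G p (k + 2)) := by
  refine ⟨torsionSubgroup_le_layer, fun v hv hvL s hs hsv => by_contra fun hs1 => hly ?_,
    fun v hv hvL s hs => Rel.trans hv ((Rel.symm hv).mul_of_mem_layer hp hP hy' hvL s hs)⟩
  have hvk : v ∉ layer G p (k + 1) := fun hvk => hly (Rel.mul_of_mem_layer hp hP hv hvk hy l hl)
  exact Rel.mul_of_rel_mul hp hP hv hvk hvL hy hy' hs hs1 ((Rel.symm hv).trans hsv) l hl

theorem inv_mul_mul_mem_of_splitsOver (S : OddDouble H₀ H b) (he : e * e = 1) (hV : A.IsASet V)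
    (hVe : ∀ v ∈ V, v * e ∈ H) (hVP : SplitsOver V P L) (heL : e ∈ L) (hbL : b ∈ L) (hl : l ∈ P)
    (hlH : l ∈ H₀) (hl1 : l ≠ 1) (hel : A.Rel e (l * e)) (hx : x ∈ H₀) (hxV : x * e ∈ V)
    (hxL : x * e ∈ L) (hxb : x * (e * b) ∉ V) : l⁻¹ * (x * (e * b)) ∈ V := by
  set D := unpaired H₀ b V e
  have hsub : (l * ·) '' {y | y ∈ D ∧ l * e * y ∈ V} ⊆ {y | y ∈ D ∧ e * y ∈ V} := by
    rintro _ ⟨y, ⟨hy, hly⟩, rfl⟩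
    rw [mul_right_comm] at hly
    exact ⟨hVP.mul_mem_unpaired heL hbL hl hlH hl1 hy hly, mul_comm (l * y) e ▸ hly⟩
  have heq := Set.eq_of_subset_of_ncard_le hsub (by
    rw [Set.ncard_image_of_injective _ (mul_right_injective l),
      ncard_eq_of_rel hV (hV.unpaired S he hVe) hel])
  have hxD : x ∈ {y | y ∈ D ∧ e * y ∈ V} := ⟨⟨hx, fun h => hxb (h.1 hxV)⟩, mul_comm x e ▸ hxV⟩
  obtain ⟨y, ⟨hy, -⟩, rfl⟩ := heq.ge hxD
  simp only [mul_assoc, inv_mul_cancel_left] at hxV hxL ⊢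
  have hye : y * e ∉ V := fun h =>
    hl1 (hVP.eq_one _ h ((L.mul_mem_cancel_left (hVP.le hl)).1 hxL) l hl hxV)
  by_contra hn
  exact hy.2 (iff_of_false hye hn)

theorem mul_mem_of_splitsOver (S : OddDouble H₀ H b) (he : e * e = 1) (hV : A.IsASet V)
    (hVe : ∀ v ∈ V, v * e ∈ H) (hVP : SplitsOver V P L) (hPH : P ≤ H₀) (heL : e ∈ L) (hbL : b ∈ L)
    (heP : ∀ l ∈ P, A.Rel e (l * e)) (hl : l ∈ P) (hl1 : l ≠ 1) (hx : x ∈ H₀) (hxV : x * e ∈ V)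
    (hxL : x * e ∈ L) : x * (e * b) ∈ V := by
  by_contra hxb
  have hinv : ∀ k ∈ P, k ≠ 1 → k⁻¹ * (x * (e * b)) ∈ V := fun k hk hk1 =>
    inv_mul_mul_mem_of_splitsOver S he hV hVe hVP heL hbL hk (hPH hk) hk1 (heP k hk) hx hxV hxL hxb
  have hmem := hinv l⁻¹ (P.inv_mem hl) (inv_ne_one.2 hl1)
  have hL : l⁻¹ * (x * (e * b)) ∈ L := by
    rw [← mul_assoc x]
    exact L.mul_mem (L.inv_mem (hVP.le hl)) (L.mul_mem hxL hbL)
  have hll := hVP.eq_one _ (hinv l hl hl1) hL (l * l) (P.mul_mem hl hl)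
    (by rwa [mul_assoc, mul_inv_cancel_left, ← inv_inv l])
  exact hl1 (eq_one_of_mul_self_eq_one S.odd_card (hPH hl) hll)

theorem notMem_of_splitsOver (S : OddDouble H₀ H b) (he : e * e = 1) (hV : A.IsASet V)
    (hVe : ∀ v ∈ V, v * e ∈ H) (hVP : SplitsOver V P L) (hPH : P ≤ H₀) (heL : e ∈ L) (hbL : b ∈ L)
    (heP : ∀ l ∈ P, A.Rel e (l * e)) (hebP : ∀ l ∈ P, A.Rel (e * b) (l * (e * b))) (hl : l ∈ P)
    (hl1 : l ≠ 1) (hlb : A.Rel b (l * b)) : ∀ v ∈ V, v ∉ L := by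
  have hVeb : ∀ v ∈ V, v * (e * b) ∈ H := fun v hv => mul_assoc v e b ▸ H.mul_mem (hVe v hv) S.mem
  have hb : ∀ v ∈ V, v ∈ L → b * v ∈ V := by
    intro v hv hvL
    obtain ⟨x, hx, rfl | rfl⟩ := S.exists_eq_mul he (hVe v hv)
    · rw [mul_comm, mul_assoc]
      exact mul_mem_of_splitsOver S he hV hVe hVP hPH heL hbL heP hl hl1 hx hv hvL
    · rw [mul_comm, mul_assoc]
      exact mul_mem_of_splitsOver S (S.mul_mul_mul_self he) hV hVeb hVP hPH (L.mul_mem heL hbL) hbL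
        hebP hl hl1 hx hv hvL
  have hnot : ∀ v ∈ V, l * b * v ∈ V → v ∉ L := fun v hv hlv hvL =>
    hl1 (hVP.eq_one _ (hb v hv hvL) (L.mul_mem hbL hvL) l hl (mul_assoc l b v ▸ hlv))
  have hsub : {v | v ∈ V ∧ l * b * v ∈ V} ⊆ {v | v ∈ V ∧ b * v ∈ V} := by
    rintro v ⟨hv, hlv⟩
    have hbv : b * v ∉ L := (L.mul_mem_cancel_left hbL).not.2 (hnot v hv hlv)
    exact ⟨hv, (hVP.mul_mem_iff hl hbv).1 (mul_assoc l b v ▸ hlv)⟩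
  have heq := Set.eq_of_subset_of_ncard_le hsub (ncard_eq_of_rel hV hV hlb).le
  intro v hv hvL
  exact hnot v hv (heq.ge ⟨hv, hb v hv hvL⟩).2 hvL

end SchurRing

theorem torsionSubgroup_le_of_coprime_index {G : Type*} [CommGroup G] {K : Subgroup G} {m : ℕ}
    (h : K.index.Coprime m) : torsionSubgroup G m ≤ K := fun x hx =>
  Subgroup.zpowers_le.2 (K.pow_index_mem x) (mem_zpowers_pow_iff.2
    (h.coprime_dvd_right (orderOf_dvd_of_pow_eq_one hx)))

theorem OddDouble.torsionSubgroup_le {G : Type*} [CommGroup G] {H₀ H : Subgroup G} {b : G} {m : ℕ}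
    (S : OddDouble H₀ H b) (hm : Odd m) : torsionSubgroup G m ≤ H₀ := by
  refine torsionSubgroup_le_of_coprime_index ?_
  rw [← Subgroup.relIndex_mul_index S.le, S.relIndex_eq_two, S.index_eq_two]
  exact Nat.Coprime.mul_left (Nat.coprime_two_left.2 hm) (Nat.coprime_two_left.2 hm)

theorem OddDouble.exists_prime_card_torsionSubgroup {G : Type*} [CommGroup G] [Finite G]
    {H₀ H K : Subgroup G} {b : G} [IsCyclic H₀] (S : OddDouble H₀ H b) (hK : K ≤ H₀) (hK1 : K ≠ ⊥) :
    ∃ p, p.Prime ∧ Nat.card (torsionSubgroup G p) = p ∧ torsionSubgroup G p ≤ K := by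
  obtain ⟨p, hp, hpK⟩ := Nat.exists_prime_and_dvd (Subgroup.card_eq_one.not.2 hK1)
  have := Fact.mk hp
  obtain ⟨x, hx⟩ := exists_prime_orderOf_dvd_card' p hpK
  have hle : torsionSubgroup G p ≤ H₀ :=
    S.torsionSubgroup_le (S.odd_card.of_dvd_nat (hpK.trans (Subgroup.card_dvd_of_le hK)))
  have hcyc : IsCyclic (torsionSubgroup G p) :=
    isCyclic_of_injective (Subgroup.inclusion hle) (Subgroup.inclusion_injective hle)
  have hxP : Subgroup.zpowers (x : G) ≤ torsionSubgroup G p :=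
    Subgroup.zpowers_le.2 (orderOf_dvd_iff_pow_eq_one.1 (Subgroup.orderOf_coe x ▸ hx.dvd))
  have hcard : Nat.card (Subgroup.zpowers (x : G)) = p := by
    rw [Nat.card_zpowers, Subgroup.orderOf_coe, hx]
  have hdvd : Nat.card (torsionSubgroup G p) ∣ p := by
    rw [← IsCyclic.exponent_eq_card]
    exact Monoid.exponent_dvd_of_forall_pow_eq_one fun y => Subtype.ext y.2
  have heq := Subgroup.eq_of_le_of_card_ge hxP ((Nat.le_of_dvd hp.pos hdvd).trans_eq hcard.symm)
  exact ⟨p, hp, heq ▸ hcard, heq ▸ Subgroup.zpowers_le.2 x.2⟩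

namespace SchurRing

variable {G : Type*} [CommGroup G] [Finite G] {A : SchurRing G} {H₀ H : Subgroup G} {b e : G}

theorem rel_mul_of_torsionSubgroup_le {p : ℕ} {z : G} (S : OddDouble H₀ H b)
    (hH : A.IsASet (H : Set G)) (he : e * e = 1) (heb : A.Rel e (e * b)) (hp : p.Prime)
    (hP : Nat.card (torsionSubgroup G p) = p)
    (hPU : torsionSubgroup G p ≤ A.involutionHull H₀ b ⊓ H₀) (hz : z * e ∈ H) :
    ∀ l ∈ torsionSubgroup G p, A.Rel z (l * z) := by
  have hPH : torsionSubgroup G p ≤ H₀ := hPU.trans inf_le_right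
  have hp2 : Odd p := hP ▸ S.odd_card.of_dvd_nat (Subgroup.card_dvd_of_le hPH)
  have hlayer : ∀ {x : G}, x * x = 1 → ∀ {k}, x ∈ layer G p k := fun hx =>
    mem_layer_of_pow_eq_one (Nat.coprime_two_left.2 hp2) (by rwa [pow_two])
  have hlift : ∀ {z}, z * e ∈ H →
      (∀ y, A.Rel z y → y ∉ layer G p 1 → ∀ l ∈ torsionSubgroup G p, A.Rel y (l * y)) →
      ∀ l ∈ torsionSubgroup G p, A.Rel z (l * z) :=
    fun hz => rel_mul_of_forall_notMem_layer S hH he heb hp hp2 hP hPU hz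
  have hself : e * e ∈ H := he ▸ H.one_mem
  have heP : ∀ l ∈ torsionSubgroup G p, A.Rel e (l * e) :=
    hlift hself fun y hy => hy.symm.mul_of_mem_layer hp hP (hlayer he)
  have hebP : ∀ l ∈ torsionSubgroup G p, A.Rel (e * b) (l * (e * b)) :=
    hlift (rel_mul_mem S hH he hself heb) fun y hy =>
      hy.symm.mul_of_mem_layer hp hP (hlayer (S.mul_mul_mul_self he))
  refine hlift hz fun y hzy hy => by_contra fun hnot => ?_
  push Not at hnot
  obtain ⟨l, hl, hly⟩ := hnot
  obtain ⟨_ | k, hk, hyk, hyk'⟩ := exists_notMem_layer hy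
  · omega
  have hl1 : l ≠ 1 := fun h => hly (by rw [h, one_mul]; exact Rel.refl y)
  have hlb : A.Rel b (l * b) := by
    simpa using rel_mul_mul_involution S hH (hPU hl).1 (hPU hl).2 H₀.one_mem
  exact notMem_of_splitsOver S he (isASet_basicSet y)
    (fun v hv => rel_mul_mem S hH he (rel_mul_mem S hH he hz hzy) hv)
    (splitsOver_basicSet hp hP hyk hyk' hl hly) hPH (hlayer he) (hlayer S.mul_self) heP hebP
    hl hl1 hlb y (mem_basicSet_self y) hyk'

theorem exists_forall_rel_mul [IsCyclic H₀] (S : OddDouble H₀ H b) (hH : A.IsASet (H : Set G))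
    (he : e * e = 1) (hne : A.basicSet e ≠ {e}) (hneb : A.basicSet e ≠ {e, e * b}) :
    ∃ r ∈ H₀, r ≠ 1 ∧ ∀ h ∈ H₀, A.Rel (h * e) (r * h * e) := by
  by_cases heb : A.Rel e (e * b)
  swap
  · exact exists_forall_rel_mul_of_not_rel S hH he heb hne
  by_cases hU : A.involutionHull H₀ b ⊓ H₀ = ⊥
  · exact exists_forall_rel_mul_of_basicSet_eq_singleton S hH he (basicSet_involution_eq S hH hU)
      heb hneb
  obtain ⟨p, hp, hP, hPU⟩ := S.exists_prime_card_torsionSubgroup inf_le_right hU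
  obtain ⟨r, hr, hr1⟩ := exists_ne_one_of_card_eq_prime hp hP
  refine ⟨r, (hPU hr).2, hr1, fun h hh => ?_⟩
  rw [mul_assoc]
  exact rel_mul_of_torsionSubgroup_le S hH he heb hp hP hPU
    (by rw [mul_assoc, he, mul_one]; exact S.le hh) r hr

end SchurRing

theorem OddDouble.of_isCompl {G : Type*} [CommGroup G] [Finite G] {H₀ H K : Subgroup G} {b : G}
    (hodd : Odd (Nat.card H₀)) (hH : Nat.card H = 2 * Nat.card H₀) (hle : H₀ ≤ H)
    (hHK : IsCompl H K) (hK : Nat.card K = 2) (hbH : b ∈ H) (hb : orderOf b = 2) :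
    OddDouble H₀ H b := by
  have hrel := Subgroup.relIndex_mul_relIndex ⊥ H₀ H bot_le hle
  rw [Subgroup.relIndex_bot_left, Subgroup.relIndex_bot_left, hH, mul_comm] at hrel
  have hcompl : Subgroup.IsComplement' H K :=
    Subgroup.isComplement'_of_disjoint_and_mul_eq_univ hHK.disjoint
      (by rw [← Subgroup.mul_normal, hHK.sup_eq_top, Subgroup.coe_top])
  have hb2 : b * b = 1 := by rw [← pow_two, ← hb, pow_orderOf_eq_one]
  exact {
    odd_card := hodd
    le := hle
    relIndex_eq_two := Nat.eq_of_mul_eq_mul_right Nat.card_pos hrel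
    index_eq_two := hcompl.symm.index_eq_card.trans hK
    mem := hbH
    notMem := fun hb₀ => by simp [eq_one_of_mul_self_eq_one hodd hb₀ hb2] at hb
    mul_self := hb2 }

theorem SchurRing.mem_rad_inter_mul_singleton {G : Type*} [CommGroup G] [Finite G] {A : SchurRing G}
    {K : Subgroup G} {r e : G} (hr : r ∈ K) (hrel : ∀ h ∈ K, A.Rel (h * e) (r * h * e)) {X : Set G}
    (hX : X ∈ A.basicSets) : r ∈ rad (X ∩ ((K : Set G) * {e})) := by
  refine mem_rad_iff.2 ?_
  rintro _ ⟨hhX, h, hh, e, rfl, rfl⟩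
  rw [← mul_assoc]
  refine ⟨?_, Set.mul_mem_mul (K.mul_mem hr hh) rfl⟩
  rw [eq_basicSet_of_mem hX hhX]
  exact hrel h hh

end SchurRings

theorem theorem1p4 {G : Type*} [CommGroup G] [Finite G] (n : ℕ) (hn : 1 < n) (hodd : Odd n)
    (H : Subgroup G) (hcyc : IsCyclic H) (hH : Nat.card H = 2 * n)
    (a : G) (ha : orderOf a = 2) (hG : IsCompl H (Subgroup.zpowers a))
    (b : G) (hbH : b ∈ H) (hb : orderOf b = 2)
    (H₀ : Subgroup G) (hH₀H : H₀ ≤ H) (hH₀ : Nat.card H₀ = n)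
    (A : SchurRings.SchurRing G)
    (hHA : SchurRings.underline (H : Set G) ∈ A.toSubring)
    (haA : SchurRings.underline ({a} : Set G) ∉ A.toSubring) :
    ({a, a * b} : Set G) ∈ A.basicSets ∨
      (⨅ X ∈ {X ∈ A.basicSets | (X ∩ ((H₀ : Set G) * {a})).Nonempty},
        SchurRings.rad (X ∩ ((H₀ : Set G) * {a}))) ≠ ⊥ := by
  by_cases hab : A.basicSet a = {a, a * b}
  · exact Or.inl (hab ▸ SchurRings.SchurRing.basicSet_mem_basicSets a)
  refine Or.inr fun hbot => ?_
  have hH₀cyc : IsCyclic H₀ :=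
    isCyclic_of_injective (Subgroup.inclusion hH₀H) (Subgroup.inclusion_injective hH₀H)
  have S : SchurRings.OddDouble H₀ H b :=
    .of_isCompl (hH₀ ▸ hodd) (hH₀ ▸ hH) hH₀H hG ((Nat.card_zpowers a).trans ha) hbH hb
  have hasingle : A.basicSet a ≠ {a} := fun h =>
    haA (SchurRings.SchurRing.isASet_iff_underline_mem.1
      (h ▸ SchurRings.SchurRing.isASet_basicSet a))
  obtain ⟨r, hr, hr1, hrel⟩ := SchurRings.SchurRing.exists_forall_rel_mul S
    (SchurRings.SchurRing.isASet_iff_underline_mem.2 hHA)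
    (by rw [← pow_two, ← ha, pow_orderOf_eq_one]) hasingle hab
  refine hr1 (Subgroup.mem_bot.1 (hbot ▸ ?_))
  simp only [Subgroup.mem_iInf]
  exact fun X hX => SchurRings.SchurRing.mem_rad_inter_mul_singleton hr hrel hX.1
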